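/- A \emph{continuous propositional logic} is a set $S$ with operations $\neg,\tfrac12$ (unary) and $\dot-$ (binary). On $[0,1]$ we put $\neg x=1-x$, $\tfrac12x=x/2$, $x\dot-y=\max(x-y,0)$, and we use these pointwise on $C(X,[0,1])$ and on $L^1(\mu,[0,1])$, the space of $[0,1]$-valued random variables on a probability space $(\Omega,\mathcal F,\mu)$ modulo a.e. equality, with metric $d(f,g)=\int|f-g|\,d\mu$. The \emph{Stone space} $\widetilde S$ is the set of homomorphisms $S\to[0,1]$ with the topology of pointwise convergence, and $\theta_S\colon S\to C(\widetilde S,[0,1])$ is $\theta_S(a)(v)=v(a)$. Let $\mathcal L_{RV}=\{0,\neg,\tfrac12,\dot-\}$. An $\mathcal L_{RV}$-structure is a complete metric space of diameter at most $1$ with a point $0$ and uniformly continuous operations $\neg,\tfrac12,\dot-$; isomorphisms are isometric bijections respecting these. Write $1=\neg0$, $E(x)=d(x,0)$, $x\wedge y=x\dot-(x\dot-y)$. The theory $RV$ consists of the axioms (for all $x,y$): $E(x)=E(x\dot-y)+E(y\wedge x)$; $E(1)=1$; $d(x,y)=E(x\dot-y)+E(y\dot-x)$; and $\tau=0$ (for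 all values of its variables) for every term $\tau$ to which every truth assignment, i.e. every homomorphism from the term algebra to $[0,1]$, gives the value $0$. (The term algebra is regarded as the logic freely generated by the variables and the symbol $0$.) The theory $ARV$ is $RV$ together with: for all $x$, $\inf_y\max\bigl(E(y\wedge\neg y),\,|E(y\wedge x)-\tfrac12E(x)|\bigr)=0$. \textbf{Theorem.} Let $M$ be a model of $RV$. \begin{enumerate} \item $\widetilde M$ is compact and Hausdorff. \item $\theta_M\colon M\to C(\widetilde M,[0,1])$ is bijective and respects $\neg,\tfrac12,\dot-$. \item There is a regular Borel probability measure $\mu$ on $\widetilde M$ such that the natural map $\rho_\mu\colon C(\widetilde M,[0,1])\to L^1(\mu,[0,1])$ is bijective and $\rho_\mu\circ\theta_M\colon M\to L^1(\mu,[0,1])$ is an isomorphism of $\mathcal L_{RV}$-structures; and $\mu$ is the only regular Borel probability measure on $\widetilde M$ for which $\rho_\mu\circ\theta_M$ is an isomorphism of $\mathcal L_{RV}$-structures. \end{enumerate} Moreover, these properties characterise $(\widetilde M,\mu,\theta_M)$ up to a unique measure-preserving homeomorphism: if $X$ is a compact Hausdorff space, $\nu$ a regular Borel probability measure on $X$,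 and $\theta\colon M\to C(X,[0,1])$ a bijection respecting $\neg,\tfrac12,\dot-$ such that $\rho_\nu$ is bijective and $\rho_\nu\circ\theta$ is an isomorphism of $\mathcal L_{RV}$-structures, then there is exactly one measure-preserving homeomorphism $h\colon X\to\widetilde M$ with $\theta_M(a)\circ h=\theta(a)$ for all $a\in M$. Consequently, every $L^1(\mu,[0,1])$ over a probability space is a model of $RV$, and an $\mathcal L_{RV}$-structure is a model of $RV$ if and only if it is isomorphic to $L^1(\mu,[0,1])$ for some probability space. A structure $L^1(\mu,[0,1])$ is a model of $ARV$ if and only if the probability space is atomless (every measurable set of positive measure has a measurable subset of strictly smaller positive measure), and an $\mathcal L_{RV}$-structure is a model of $ARV$ if and only if it is isomorphic to $L^1(\mu,[0,1])$ for some atomless probability space. -/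

import Mathlib

open MeasureTheory

namespace RandomVar

/-! ### Continuous propositional logics -/

/-- The signature of continuous propositional logics: unary `¬`, unary `½` and binary `∸`. -/
class ContLogic (S : Type*) where
  neg : S → S
  half : S → S
  dotminus : S → S → S

infixl:65 " ∸ " => ContLogic.dotminus

open ContLogic

/-- The abbreviation `x ∧ y := x ∸ (x ∸ y)`. -/
def meet {S : Type*} [ContLogic S] (x y : S) : S := x ∸ (x ∸ y)

/-- Homomorphisms of continuous propositional logics. -/
structure IsLogicHom {S T : Type*} [ContLogic S] [ContLogic T] (f : S → T) : Prop where
  map_neg : ∀ x, f (neg x) = neg (f x)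
  map_half : ∀ x, f (half x) = half (f x)
  map_dotminus : ∀ x y, f (x ∸ y) = f x ∸ f y

/-- The natural interpretation of the connectives on `[0,1]`:
`¬x = 1 - x`, `½x = x/2`, `x ∸ y = max (x - y) 0`. -/
noncomputable instance : ContLogic unitInterval where
  neg x := ⟨1 - (x : ℝ), by have := x.2.1; have := x.2.2; constructor <;> linarith⟩
  half x := ⟨(x : ℝ) / 2, by have := x.2.1; have := x.2.2; constructor <;> linarith⟩
  dotminus x y := ⟨max ((x : ℝ) - y) 0, le_max_right _ _, by
    have := x.2.2; have := y.2.1; exact max_le (by linarith) zero_le_one⟩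

/-- The pointwise connectives on `C(X,[0,1])`. -/
noncomputable instance {X : Type*} [TopologicalSpace X] : ContLogic C(X, unitInterval) where
  neg f := ⟨fun x => neg (f x), by
    refine Continuous.subtype_mk (f := fun x => 1 - (f x : ℝ)) ?_ _; fun_prop⟩
  half f := ⟨fun x => half (f x), by
    refine Continuous.subtype_mk (f := fun x => (f x : ℝ) / 2) ?_ _; fun_prop⟩
  dotminus f g := ⟨fun x => f x ∸ g x, by
    refine Continuous.subtype_mk (f := fun x => max ((f x : ℝ) - g x) 0) ?_ _; fun_prop⟩

/-- The Stone space of a continuous propositional logic: the set of truth assignments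
`S → [0,1]`, with the topology of pointwise convergence. -/
def StoneSpace (S : Type*) [ContLogic S] : Type _ :=
  {v : S → unitInterval // IsLogicHom v}

instance (S : Type*) [ContLogic S] : TopologicalSpace (StoneSpace S) :=
  inferInstanceAs (TopologicalSpace {v : S → unitInterval // IsLogicHom v})

/-- Stone spaces carry their Borel σ-algebra. -/
instance (S : Type*) [ContLogic S] : MeasurableSpace (StoneSpace S) := borel _

instance (S : Type*) [ContLogic S] : BorelSpace (StoneSpace S) := ⟨rfl⟩

/-- The map `θ : S → C(S̃,[0,1])`, `θ(φ)(v) = v(φ)`. -/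
def stoneMap (S : Type*) [ContLogic S] (φ : S) : C(StoneSpace S, unitInterval) :=
  ⟨fun v => v.1 φ, (continuous_apply φ).comp continuous_subtype_val⟩

/-! ### Structures in the language `{0, ¬, ½, ∸}` -/

/-- The function symbols of the language of random variables. -/
class RVOps (M : Type*) extends ContLogic M where
  zero : M

/-- A metric structure in the language of random variables: a complete metric space of diameter
at most one, with uniformly continuous interpretations of the function symbols. -/
class RVStructure (M : Type*) [MetricSpace M] extends RVOps M where
  complete : CompleteSpace M
  dist_le_one : ∀ x y : M, dist x y ≤ 1
  uniformContinuous_neg : UniformContinuous (neg : M → M)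
  uniformContinuous_half : UniformContinuous (half : M → M)
  uniformContinuous_dotminus : UniformContinuous (fun p : M × M => p.1 ∸ p.2)

/-- Isomorphisms of structures: isometric bijections respecting the function symbols. -/
structure IsRVIso {M N : Type*} [MetricSpace M] [RVStructure M] [MetricSpace N] [RVStructure N]
    (f : M → N) : Prop extends IsLogicHom f where
  bijective : Function.Bijective f
  isometry : Isometry f
  map_zero : f RVOps.zero = RVOps.zero

/-- The term algebra of the language, on countably many variables. -/
inductive RVTerm : Type
  | var (n : ℕ) : RVTerm
  | zero : RVTerm
  | neg (τ : RVTerm) : RVTerm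
  | half (τ : RVTerm) : RVTerm
  | dotminus (τ σ : RVTerm) : RVTerm

/-- The term algebra is a continuous propositional logic, freely generated by the variables
together with the symbol `0` (which is thus an atomic proposition of this logic). -/
instance : ContLogic RVTerm where
  neg := RVTerm.neg
  half := RVTerm.half
  dotminus := RVTerm.dotminus

/-- The value of a term at a tuple of elements of a structure. -/
def RVTerm.eval {M : Type*} [RVOps M] (a : ℕ → M) : RVTerm → M
  | .var n => a n
  | .zero => RVOps.zero
  | .neg τ => ContLogic.neg (τ.eval a)
  | .half τ => ContLogic.half (τ.eval a)
  | .dotminus τ σ => τ.eval a ∸ σ.eval a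

/-- A term is valid if every truth assignment to the term algebra gives it the value `0`
(the value representing truth). -/
def RVTerm.Valid (τ : RVTerm) : Prop := ∀ v : StoneSpace RVTerm, v.1 τ = 0

section Theories

variable (M : Type*) [MetricSpace M] [RVStructure M]

/-- The abbreviation `1 := ¬0`. -/
def one : M := neg RVOps.zero

variable {M} in
/-- The abbreviation `E(x) := d(x, 0)`. -/
noncomputable def E (x : M) : ℝ := dist x RVOps.zero

/-- The theory `RV`. -/
structure ModelsRV : Prop where
  rv1 : ∀ x y : M, E x = E (x ∸ y) + E (meet y x)
  rv2 : E (one M) = 1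
  rv3 : ∀ x y : M, dist x y = E (x ∸ y) + E (y ∸ x)
  rv4 : ∀ τ : RVTerm, τ.Valid → ∀ a : ℕ → M, τ.eval a = RVOps.zero

/-- The theory `ARV`. -/
structure ModelsARV : Prop extends ModelsRV M where
  arv : ∀ x : M, ⨅ y : M, max (E (meet y (neg y))) |E (meet y x) - E x / 2| = 0

end Theories

/-! ### Spaces of `[0,1]`-valued random variables -/

/-- `L¹(μ,[0,1])`: classes of `[0,1]`-valued random variables up to almost everywhere equality,
with the metric of `L¹`, i.e. `d(f, g) = ∫ |f - g| dμ`. -/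
abbrev L1I {Ω : Type*} [MeasurableSpace Ω] (μ : Measure Ω) : Type _ :=
  {f : Lp ℝ 1 μ // ∀ᵐ ω ∂μ, f ω ∈ Set.Icc (0 : ℝ) 1}

section L1I

variable {Ω : Type*} [MeasurableSpace Ω] (μ : Measure Ω) [IsProbabilityMeasure μ]

theorem mem_L1I_iff (f : Lp ℝ 1 μ) :
    (∀ᵐ ω ∂μ, f ω ∈ Set.Icc (0 : ℝ) 1) ↔ f ∈ Set.Icc 0 (Lp.const 1 μ (1 : ℝ)) := by
  have h1 : (Lp.const 1 μ (1 : ℝ) : Ω → ℝ) =ᵐ[μ] fun _ => 1 := Lp.coeFn_const ..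
  have h0 : ((0 : Lp ℝ 1 μ) : Ω → ℝ) =ᵐ[μ] 0 := Lp.coeFn_zero ..
  rw [Set.mem_Icc, ← Lp.coeFn_le, ← Lp.coeFn_le, Filter.EventuallyLE, Filter.EventuallyLE,
    ← Filter.eventually_and]
  apply Filter.eventually_congr
  filter_upwards [h0, h1] with ω h0 h1
  rw [h0, h1]; rfl

instance L1I.instCompleteSpace : CompleteSpace (L1I μ) := by
  have : IsClosed {f : Lp ℝ 1 μ | ∀ᵐ ω ∂μ, f ω ∈ Set.Icc (0 : ℝ) 1} := by
    simp only [mem_L1I_iff]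
    exact isClosed_Icc
  exact this.completeSpace_coe

/-- The pointwise operations on `L¹(μ,[0,1])`:
`¬f = 1 - f`, `½f = f/2`, `f ∸ g = max (f - g) 0`. -/
noncomputable instance L1I.instRVOps : RVOps (L1I μ) where
  zero := ⟨0, by
    filter_upwards [Lp.coeFn_zero ℝ 1 μ] with ω h
    rw [h]; simp⟩
  neg f := ⟨Lp.const 1 μ 1 - f.1, by
    filter_upwards [Lp.coeFn_sub (Lp.const 1 μ (1 : ℝ)) f.1, Lp.coeFn_const 1 μ (1 : ℝ), f.2]
      with ω h h1 hf
    rw [h, Pi.sub_apply, h1]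
    exact ⟨by simpa using hf.2, by simpa using hf.1⟩⟩
  half f := ⟨(1 / 2 : ℝ) • f.1, by
    filter_upwards [Lp.coeFn_smul (1 / 2 : ℝ) f.1, f.2] with ω h hf
    rw [h, Pi.smul_apply, smul_eq_mul]
    exact ⟨by linarith [hf.1], by linarith [hf.2]⟩⟩
  dotminus f g := ⟨(f.1 - g.1) ⊔ 0, by
    filter_upwards [Lp.coeFn_sup (f.1 - g.1) 0, Lp.coeFn_sub f.1 g.1, Lp.coeFn_zero ℝ 1 μ,
      f.2, g.2] with ω h h1 h0 hf hg
    rw [h, Pi.sup_apply, h1, h0, Pi.sub_apply]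
    exact ⟨le_sup_right, sup_le (by linarith [hf.2, hg.1]) zero_le_one⟩⟩

noncomputable instance L1I.instRVStructure : RVStructure (L1I μ) where
  complete := inferInstance
  dist_le_one f g := by
    rw [Subtype.dist_eq, dist_eq_norm]
    have h : ‖f.1 - g.1‖ ≤ ‖Lp.const 1 μ (1 : ℝ)‖ := by
      apply Lp.norm_le_norm_of_ae_le
      filter_upwards [Lp.coeFn_sub f.1 g.1, Lp.coeFn_const 1 μ (1 : ℝ), f.2, g.2]
        with ω h h1 hf hg
      rw [h, h1, Pi.sub_apply]
      simp only [Function.const_apply, Real.norm_eq_abs, abs_one]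
      exact abs_le.2 ⟨by linarith [hf.1, hg.2], by linarith [hf.2, hg.1]⟩
    refine h.trans ((Lp.norm_const_le 1 μ (1 : ℝ)).trans ?_)
    simp
  uniformContinuous_neg :=
    (uniformContinuous_const.sub uniformContinuous_subtype_val).subtype_mk _
  uniformContinuous_half := (uniformContinuous_subtype_val.const_smul (1 / 2 : ℝ)).subtype_mk _
  uniformContinuous_dotminus :=
    ((lipschitzWith_posPart (α := Lp ℝ 1 μ)).uniformContinuous.comp
      ((uniformContinuous_subtype_val.comp uniformContinuous_fst).sub
        (uniformContinuous_subtype_val.comp uniformContinuous_snd))).subtype_mk _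

/-- A measure is atomless if every measurable set of positive measure has a measurable subset of
strictly smaller positive measure. -/
def Atomless {Ω : Type*} [MeasurableSpace Ω] (μ : Measure Ω) : Prop :=
  ∀ A, MeasurableSet A → 0 < μ A → ∃ B ⊆ A, MeasurableSet B ∧ 0 < μ B ∧ μ B < μ A

end L1I

section Representation

variable {X : Type*} [TopologicalSpace X] [MeasurableSpace X] [BorelSpace X]

/-- The natural map `ρ : C(X,[0,1]) → L¹(μ,[0,1])`, sending a continuous function to its class. -/
noncomputable def rho (μ : Measure X) [IsProbabilityMeasure μ] (f : C(X, unitInterval)) :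
    L1I μ :=
  have hf : MemLp (fun x => (f x : ℝ)) 1 μ :=
    MemLp.of_bound (Continuous.aestronglyMeasurable (by fun_prop)) 1
      (Filter.Eventually.of_forall fun x => by
        rw [Real.norm_eq_abs, abs_of_nonneg (f x).2.1]; exact (f x).2.2)
  ⟨hf.toLp, by
    filter_upwards [hf.coeFn_toLp] with x hx
    rw [hx]; exact (f x).2⟩

/-- The properties characterising the Stone space `(X, μ, θ)` of a model `M`, for a topological
space `X` with its Borel σ-algebra, a Borel probability measure `μ` on `X` and a map
`θ : M → C(X,[0,1])`. -/
structure IsBasedOn (M : Type*) [MetricSpace M] [RVStructure M]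
    (X : Type*) [TopologicalSpace X] [MeasurableSpace X] [BorelSpace X]
    (μ : Measure X) [IsProbabilityMeasure μ] (θ : M → C(X, unitInterval)) : Prop where
  compact : CompactSpace X
  hausdorff : T2Space X
  bijective : Function.Bijective θ
  isLogicHom : IsLogicHom θ
  regular : μ.Regular
  bijective_rho : Function.Bijective (rho μ)
  isRVIso : IsRVIso (rho μ ∘ θ)

end Representation

end RandomVar

open RandomVar

universe u v w

namespace RandomVar

open ContLogic

/-! ### The connectives on the unit interval -/

section UnitInterval

variable (x y : unitInterval)

/-! The heart is a completeness argument: a model has enough truth assignments. If every truth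
assignment on `M` gives `a` a value below `2⁻ᵏ`, then by compactness of `[0,1]^M` finitely many
homomorphism equations already exclude the maps with value at least `2⁻ᵏ` at `a`, and on those maps
the sum of the errors in these equations is bounded below. Subtracting a large multiple of that sum
from `a ∸ 2⁻ᵏ` produces a valid term. In `M` the errors are zero, so `rv4` gives `a ∸ 2⁻ᵏ = 0`,
hence `E a ≤ 2⁻ᵏ`. Thus an element killed by all truth assignments is `0`, and `θ` is injective.

The range of `θ` is stable under the connectives and separates points. It is uniformly closed
because uniform closeness controls the metric through `rv3` and `M` is complete. The lattice form of
Stone–Weierstrass then makes `θ` onto.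

Transported to `C(M̃,[0,1])`, the functional `E` is positive, normalised and, by `rv1`, additive. It
extends to `C(M̃,ℝ)`, and Riesz gives `μ`. By `rv3`, `ρ ∘ θ` is isometric; its range is closed by
completeness and dense, so it is everything. Integrals of continuous functions are prescribed by
`E`, which forces uniqueness of `μ`; the homeomorphism sends a point to evaluation at it.

Conversely, the axioms hold in `L¹(μ,[0,1])` because they hold pointwise. For `ARV`, Sierpiński's
theorem applied to the measure `f dμ` finds an indicator that halves `f`; on an atom, an almost
indicator can only take almost nothing or almost everything. -/

@[simp] theorem coe_neg : ((neg x : unitInterval) : ℝ) = 1 - x := rfl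

@[simp] theorem coe_half : ((half x : unitInterval) : ℝ) = x / 2 := rfl

@[simp] theorem coe_dotminus : ((x ∸ y : unitInterval) : ℝ) = max ((x : ℝ) - y) 0 := rfl

@[simp] theorem coe_meet : ((meet x y : unitInterval) : ℝ) = min (y : ℝ) x := by
  have := y.2.1
  have := x.2.1
  simp only [meet, coe_dotminus]
  rcases le_total (x : ℝ) y with h | h
  · rw [max_eq_right (by linarith : (x : ℝ) - y ≤ 0), min_eq_right h, sub_zero,
      max_eq_left x.2.1]
  · rw [max_eq_left (by linarith : (0 : ℝ) ≤ x - y), min_eq_left h, sub_sub_cancel,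
      max_eq_left y.2.1]

end UnitInterval

/-! ### Identities and the functional `E` in models of `RV` -/

section Models

variable {M : Type*} [MetricSpace M] [RVStructure M]

theorem E_zero : E (RVOps.zero : M) = 0 := dist_self _

theorem E_nonneg (x : M) : 0 ≤ E x := dist_nonneg

/-- `rv4` speaks only of terms with value `0`, so an identity is split into two truncated
differences, and `rv3` turns their vanishing into equality. -/
theorem ModelsRV.eval_eq_eval (hM : ModelsRV M) (τ σ : RVTerm)
    (h : ∀ v : StoneSpace RVTerm, v.1 τ = v.1 σ) (a : ℕ → M) : τ.eval a = σ.eval a := by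
  have h1 : τ.eval a ∸ σ.eval a = RVOps.zero := hM.rv4 (τ ∸ σ) (fun v => by
    rw [v.2.map_dotminus, h v]
    ext
    simp) a
  have h2 : σ.eval a ∸ τ.eval a = RVOps.zero := hM.rv4 (σ ∸ τ) (fun v => by
    rw [v.2.map_dotminus, h v]
    ext
    simp) a
  rw [← dist_eq_zero, hM.rv3, h1, h2, E_zero, add_zero]

theorem ModelsRV.dotminus_self (hM : ModelsRV M) (x : M) : x ∸ x = RVOps.zero :=
  hM.rv4 (RVTerm.var 0 ∸ RVTerm.var 0) (fun v => by
    rw [v.2.map_dotminus]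
    ext
    simp) fun _ => x

theorem ModelsRV.dotminus_zero (hM : ModelsRV M) (x : M) : x ∸ RVOps.zero = x := by
  -- The symbol `0` is an atom of the term algebra, to which a truth assignment may give any value;
  -- `x ∸ x` therefore stands in for it in identities.
  have := hM.eval_eq_eval (RVTerm.var 0 ∸ (RVTerm.var 0 ∸ RVTerm.var 0)) (RVTerm.var 0)
    (fun v => by
      rw [v.2.map_dotminus, v.2.map_dotminus]
      ext
      simpa using (v.1 (RVTerm.var 0)).2.1) fun _ => x
  change x ∸ (x ∸ x) = x at this
  rwa [hM.dotminus_self] at this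

theorem ModelsRV.meet_half_self (hM : ModelsRV M) (x : M) : meet (half x) x = half x := by
  refine hM.eval_eq_eval (meet (half (RVTerm.var 0)) (RVTerm.var 0)) (half (RVTerm.var 0))
    (fun v => ?_) fun _ => x
  simp only [meet, v.2.map_dotminus, v.2.map_half]
  rw [← meet]
  ext
  have := (v.1 (RVTerm.var 0)).2.1
  simpa using this

theorem ModelsRV.dotminus_half_self (hM : ModelsRV M) (x : M) : x ∸ half x = half x := by
  refine hM.eval_eq_eval (RVTerm.var 0 ∸ half (RVTerm.var 0)) (half (RVTerm.var 0))
    (fun v => ?_) fun _ => x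
  simp only [v.2.map_dotminus, v.2.map_half]
  ext
  have := (v.1 (RVTerm.var 0)).2.1
  simp only [coe_dotminus, coe_half]
  rw [max_eq_left] <;> linarith

theorem ModelsRV.meet_comm (hM : ModelsRV M) (x y : M) : meet x y = meet y x := by
  refine hM.eval_eq_eval (meet (RVTerm.var 0) (RVTerm.var 1)) (meet (RVTerm.var 1) (RVTerm.var 0))
    (fun v => ?_) fun n => if n = 0 then x else y
  simp only [meet, v.2.map_dotminus]
  rw [← meet, ← meet]
  ext
  simp [min_comm]

/-- Apply `rv1` in both orders: `E x` is `E` of the meet, which is a summand of `E y`. -/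
theorem ModelsRV.E_le_of_dotminus_eq_zero (hM : ModelsRV M) {x y : M}
    (h : x ∸ y = RVOps.zero) : E x ≤ E y := by
  have h1 := hM.rv1 x y
  have h2 := hM.rv1 y x
  rw [h, E_zero, hM.meet_comm] at h1
  linarith [E_nonneg (y ∸ x)]

theorem ModelsRV.E_half (hM : ModelsRV M) (x : M) : E (half x) = E x / 2 := by
  have := hM.rv1 x (half x)
  rw [hM.dotminus_half_self, hM.meet_half_self] at this
  linarith

theorem ModelsRV.E_half_iterate_one (hM : ModelsRV M) (k : ℕ) :
    E (half^[k] (one M)) = (1 / 2) ^ k := by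
  induction k with
  | zero => simpa using hM.rv2
  | succ k ih =>
    rw [Function.iterate_succ_apply', hM.E_half, ih]
    ring

end Models

/-! ### Existence of truth assignments -/

/-- The term for the absolute value of a difference. -/
def absDiff {T : Type*} [ContLogic T] (x y : T) : T := neg (neg (x ∸ y) ∸ (y ∸ x))

@[simp] theorem coe_absDiff (x y : unitInterval) :
    ((absDiff x y : unitInterval) : ℝ) = |(x : ℝ) - y| := by
  have := x.2
  have := y.2
  simp only [absDiff, coe_neg, coe_dotminus]
  rcases le_total (x : ℝ) y with h | h
  · rw [max_eq_right (by linarith : (x : ℝ) - y ≤ 0), max_eq_left (by linarith : (0 : ℝ) ≤ y - x),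
      max_eq_left (by linarith [x.2.1, y.2.2]), abs_of_nonpos (by linarith)]
    ring
  · rw [max_eq_left (by linarith : (0 : ℝ) ≤ x - y), max_eq_right (by linarith : (y : ℝ) - x ≤ 0),
      max_eq_left (by linarith [y.2.1, x.2.2]), abs_of_nonneg (by linarith)]
    ring

/-- The three connectives, indexed, as binary operations. -/
def connective {T : Type*} [ContLogic T] (i : Fin 3) (x y : T) : T :=
  match i with
  | 0 => neg x
  | 1 => half x
  | 2 => x ∸ y

theorem IsLogicHom.map_connective {S T : Type*} [ContLogic S] [ContLogic T] {f : S → T}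
    (hf : IsLogicHom f) (i : Fin 3) (x y : S) :
    f (connective i x y) = connective i (f x) (f y) := by
  fin_cases i
  exacts [hf.map_neg x, hf.map_half x, hf.map_dotminus x y]

theorem IsLogicHom.of_map_connective {S T : Type*} [ContLogic S] [ContLogic T] {f : S → T}
    (hf : ∀ i x y, f (connective i x y) = connective i (f x) (f y)) : IsLogicHom f :=
  ⟨fun x => hf 0 x x, fun x => hf 1 x x, fun x y => hf 2 x y⟩

theorem IsLogicHom.map_absDiff {S T : Type*} [ContLogic S] [ContLogic T] {f : S → T}
    (hf : IsLogicHom f) (x y : S) : f (absDiff x y) = absDiff (f x) (f y) := by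
  simp only [absDiff, hf.map_neg, hf.map_dotminus]

theorem IsLogicHom.map_meet {S T : Type*} [ContLogic S] [ContLogic T] {f : S → T}
    (hf : IsLogicHom f) (x y : S) : f (meet x y) = meet (f x) (f y) := by
  simp only [meet, hf.map_dotminus]

theorem IsLogicHom.comp {S T U : Type*} [ContLogic S] [ContLogic T] [ContLogic U] {g : T → U}
    {f : S → T} (hg : IsLogicHom g) (hf : IsLogicHom f) : IsLogicHom (g ∘ f) :=
  ⟨fun x => by simp [hf.map_neg, hg.map_neg], fun x => by simp [hf.map_half, hg.map_half],
    fun x y => by simp [hf.map_dotminus, hg.map_dotminus]⟩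

theorem continuous_connective (i : Fin 3) :
    Continuous fun p : unitInterval × unitInterval => connective i p.1 p.2 := by
  refine Continuous.subtype_mk (p := fun z => z ∈ unitInterval)
    (f := fun p : unitInterval × unitInterval =>
      ((connective i p.1 p.2 : unitInterval) : ℝ)) ?_ fun p => Subtype.prop _
  fin_cases i
  · change Continuous fun p : unitInterval × unitInterval => 1 - (p.1 : ℝ)
    fun_prop
  · change Continuous fun p : unitInterval × unitInterval => (p.1 : ℝ) / 2
    fun_prop
  · change Continuous fun p : unitInterval × unitInterval => max ((p.1 : ℝ) - p.2) 0
    fun_prop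

/-- Since the subtracted values are nonnegative, truncating at each stage or only at the end is the
same. This lets a term subtract a sum that may exceed `1`. -/
theorem IsLogicHom.coe_foldl_dotminus {T : Type*} [ContLogic T] {v : T → unitInterval}
    (hv : IsLogicHom v) (L : List T) (τ : T) :
    (v (L.foldl ContLogic.dotminus τ) : ℝ) =
      max ((v τ : ℝ) - (L.map fun σ => (v σ : ℝ)).sum) 0 := by
  induction L generalizing τ with
  | nil => simpa using (v τ).2.1
  | cons σ L ih =>
    have h : 0 ≤ (L.map fun σ => (v σ : ℝ)).sum := List.sum_nonneg (by
      simp only [List.mem_map, forall_exists_index, and_imp, forall_apply_eq_imp_iff₂]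
      exact fun t _ => (v t).2.1)
    rw [List.foldl_cons, ih, hv.map_dotminus, coe_dotminus, List.map_cons, List.sum_cons]
    rcases le_total ((v τ : ℝ) - v σ) 0 with h1 | h1
    · rw [max_eq_right h1, max_eq_right (by linarith), max_eq_right (by linarith)]
    · rw [max_eq_left h1, sub_sub]

theorem sum_map_flatten_replicate {T : Type*} (f : T → ℝ) (L : List T) (N : ℕ) :
    (((List.replicate N L).flatten).map f).sum = N * (L.map f).sum := by
  induction N with
  | zero => simp
  | succ N ih =>
    rw [List.replicate_succ, List.flatten_cons, List.map_append, List.sum_append, ih]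
    push_cast
    ring

section Models

variable {M : Type*} [MetricSpace M] [RVStructure M]

theorem ModelsRV.eval_foldl_dotminus (hM : ModelsRV M) (e : ℕ → M) (L : List RVTerm)
    (hL : ∀ σ ∈ L, σ.eval e = RVOps.zero) (τ : RVTerm) :
    (L.foldl ContLogic.dotminus τ).eval e = τ.eval e := by
  induction L generalizing τ with
  | nil => rfl
  | cons σ L ih =>
    rw [List.foldl_cons, ih fun ρ hρ => hL ρ (List.mem_cons_of_mem _ hρ)]
    change τ.eval e ∸ σ.eval e = _
    rw [hL σ List.mem_cons_self, hM.dotminus_zero]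

theorem ModelsRV.absDiff_self (hM : ModelsRV M) (x : M) : absDiff x x = RVOps.zero :=
  hM.rv4 (absDiff (RVTerm.var 0) (RVTerm.var 0)) (fun v => by
    rw [v.2.map_absDiff]
    ext
    simp) fun _ => x

theorem eval_connective (e : ℕ → M) (i : Fin 3) (σ τ : RVTerm) :
    (connective i σ τ).eval e = connective i (σ.eval e) (τ.eval e) := by
  fin_cases i <;> rfl

theorem eval_half_iterate (e : ℕ → M) (k : ℕ) (τ : RVTerm) :
    (half^[k] τ).eval e = half^[k] (τ.eval e) := by
  induction k with
  | zero => rfl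
  | succ k ih =>
    rw [Function.iterate_succ_apply', Function.iterate_succ_apply', ← ih]
    rfl

theorem IsLogicHom.coe_half_iterate {T : Type*} [ContLogic T] {v : T → unitInterval}
    (hv : IsLogicHom v) (k : ℕ) (τ : T) : (v (half^[k] τ) : ℝ) = (1 / 2) ^ k * v τ := by
  induction k with
  | zero => simp
  | succ k ih =>
    rw [Function.iterate_succ_apply', hv.map_half, coe_half, ih]
    ring

/-- If no truth assignment gives `a` a value at least `2⁻ᵏ`, then `a ∸ 2⁻ᵏ` vanishes. -/
theorem ModelsRV.dotminus_half_iterate_one_eq_zero (hM : ModelsRV M) (a : M) (k : ℕ)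
    (h : ∀ v : StoneSpace M, (v.1 a : ℝ) < (1 / 2) ^ k) :
    a ∸ half^[k] (one M) = RVOps.zero := by
  classical
  -- The error of an arbitrary map `w` in one homomorphism equation.
  let d : Fin 3 × M × M → (M → unitInterval) → ℝ := fun c w =>
    |(w (connective c.1 c.2.1 c.2.2) : ℝ) -
      (connective c.1 (w c.2.1) (w c.2.2) : unitInterval)|
  have hd : ∀ c, Continuous (d c) := fun c => by
    have h0 : Continuous fun w : M → unitInterval => (w c.2.1, w c.2.2) := by fun_prop
    have h1 : Continuous fun w : M → unitInterval =>
        ((connective c.1 (w c.2.1) (w c.2.2) : unitInterval) : ℝ) :=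
      continuous_subtype_val.comp ((continuous_connective c.1).comp h0)
    exact ((continuous_subtype_val.comp (continuous_apply _)).sub h1).abs
  let K : Set (M → unitInterval) := {w | (1 / 2 : ℝ) ^ k ≤ w a}
  have hK : IsCompact K :=
    (isClosed_le continuous_const
      (continuous_subtype_val.comp (continuous_apply a))).isCompact
  obtain ⟨F, hF⟩ := hK.elim_finite_subfamily_closed (fun c => {w | d c w = 0})
    (fun c => isClosed_eq (hd c) continuous_const) (by
      rw [Set.eq_empty_iff_forall_notMem]
      rintro w ⟨hw, hw'⟩
      rw [Set.mem_iInter] at hw'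
      have hhom : IsLogicHom w := IsLogicHom.of_map_connective fun i x y => by
        have := hw' (i, x, y)
        exact Subtype.ext (sub_eq_zero.1 (abs_eq_zero.1 this))
      exact absurd hw (not_le.2 (h ⟨w, hhom⟩)))
  have hpos : ∀ w ∈ K, 0 < ∑ c ∈ F, d c w := by
    intro w hw
    refine (Finset.sum_nonneg fun c _ => abs_nonneg _).lt_of_ne' fun h0 => ?_
    rw [Finset.sum_eq_zero_iff_of_nonneg fun c _ => abs_nonneg _] at h0
    exact Set.eq_empty_iff_forall_notMem.1 hF w ⟨hw, Set.mem_iInter₂.2 h0⟩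
  -- The total error is continuous and positive on the compact `K`, so it has a positive lower bound
  -- there; `N` copies of it exceed `1`.
  obtain ⟨δ, hδ, hδK⟩ := hK.exists_forall_le'
    (continuous_finsetSum F fun c _ => hd c).continuousOn hpos
  obtain ⟨N, hN⟩ := exists_nat_ge (1 / δ)
  -- Only finitely many elements occur, so the countable supply of variables suffices to name them,
  -- although `M` may be uncountable.
  let S : Finset M := insert a (F.biUnion fun c => {c.2.1, c.2.2, connective c.1 c.2.1 c.2.2})
  obtain ⟨idx, hidx⟩ := Set.countable_iff_exists_injOn.1 S.countable_toSet
  have : Nonempty M := ⟨a⟩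
  let e : ℕ → M := Function.invFunOn idx S
  have he : ∀ x ∈ S, e (idx x) = x := fun x hx => hidx.leftInvOn_invFunOn hx
  let t : Fin 3 × M × M → RVTerm := fun c => absDiff (RVTerm.var (idx (connective c.1 c.2.1 c.2.2)))
    (connective c.1 (RVTerm.var (idx c.2.1)) (RVTerm.var (idx c.2.2)))
  let L : List RVTerm := (List.replicate N (F.toList.map t)).flatten
  -- A term with value `1` under every truth assignment, which `¬0` need not have.
  let o : RVTerm := neg (RVTerm.var 0 ∸ RVTerm.var 0)
  let τ : RVTerm := RVTerm.var (idx a) ∸ half^[k] o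
  have hvalid : (L.foldl ContLogic.dotminus τ).Valid := by
    intro v
    let w : M → unitInterval := fun x => v.1 (RVTerm.var (idx x))
    have hsum : (L.map fun σ => (v.1 σ : ℝ)).sum = N * ∑ c ∈ F, d c w := by
      rw [sum_map_flatten_replicate, List.map_map, Finset.sum_map_toList]
      congr 1
      refine Finset.sum_congr rfl fun c _ => ?_
      simp only [Function.comp_apply, t, v.2.map_absDiff, coe_absDiff, v.2.map_connective]
      rfl
    have ho : (v.1 o : ℝ) = 1 := by
      simp only [o, v.2.map_neg, v.2.map_dotminus, coe_neg, coe_dotminus, sub_self, max_self,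
        sub_zero]
    have hτ : (v.1 τ : ℝ) = max ((w a : ℝ) - (1 / 2) ^ k) 0 := by
      rw [v.2.map_dotminus, coe_dotminus, v.2.coe_half_iterate, ho, mul_one]
    have hnn : 0 ≤ ∑ c ∈ F, d c w := Finset.sum_nonneg fun c _ => abs_nonneg _
    ext
    rw [v.2.coe_foldl_dotminus, hsum, hτ]
    refine max_eq_right ?_
    -- On `K` the penalty is at least `1` and absorbs any value; off `K` the term `τ` is already
    -- `0`.
    by_cases hw : w ∈ K
    · have h1 : 1 ≤ N * ∑ c ∈ F, d c w := calc
        (1 : ℝ) = 1 / δ * δ := by rw [one_div_mul_cancel hδ.ne']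
        _ ≤ N * ∑ c ∈ F, d c w := mul_le_mul hN (hδK w hw) hδ.le (Nat.cast_nonneg N)
      have h2 : (0 : ℝ) ≤ (1 / 2) ^ k := by positivity
      have h3 : max ((w a : ℝ) - (1 / 2) ^ k) 0 ≤ 1 :=
        max_le (by linarith [(w a).2.2]) zero_le_one
      linarith
    · have hw' : (w a : ℝ) < (1 / 2) ^ k := not_le.1 hw
      rw [max_eq_right (by linarith)]
      have := mul_nonneg (Nat.cast_nonneg (α := ℝ) N) hnn
      linarith
  have hL : ∀ σ ∈ L, σ.eval e = RVOps.zero := by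
    intro σ hσ
    obtain ⟨l, hl, hσl⟩ := List.mem_flatten.1 hσ
    rw [List.eq_of_mem_replicate hl, List.mem_map] at hσl
    obtain ⟨c, hc, rfl⟩ := hσl
    rw [Finset.mem_toList] at hc
    have hS : ∀ x ∈ ({c.2.1, c.2.2, connective c.1 c.2.1 c.2.2} : Finset M), e (idx x) = x :=
      fun x hx => he x (Finset.mem_insert_of_mem (Finset.mem_biUnion.2 ⟨c, hc, hx⟩))
    change absDiff (e (idx (connective c.1 c.2.1 c.2.2))) (RVTerm.eval e (connective c.1
      (RVTerm.var (idx c.2.1)) (RVTerm.var (idx c.2.2)))) = _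
    rw [eval_connective]
    change absDiff (e (idx (connective c.1 c.2.1 c.2.2)))
      (connective c.1 (e (idx c.2.1)) (e (idx c.2.2))) = _
    rw [hS c.2.1 (by simp), hS c.2.2 (by simp), hS _ (by simp), hM.absDiff_self]
  have := hM.rv4 _ hvalid e
  rw [hM.eval_foldl_dotminus e L hL] at this
  change e (idx a) ∸ (half^[k] o).eval e = RVOps.zero at this
  rw [eval_half_iterate, he a (Finset.mem_insert_self _ _)] at this
  change a ∸ half^[k] (neg (e 0 ∸ e 0)) = RVOps.zero at this
  rwa [hM.dotminus_self] at this

theorem ModelsRV.eq_zero_of_forall_stoneSpace (hM : ModelsRV M) (a : M)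
    (h : ∀ v : StoneSpace M, v.1 a = 0) : a = RVOps.zero := by
  have h1 : ∀ k : ℕ, E a ≤ (1 / 2) ^ k := fun k => by
    rw [← hM.E_half_iterate_one k]
    refine hM.E_le_of_dotminus_eq_zero (hM.dotminus_half_iterate_one_eq_zero a k fun v => ?_)
    rw [h v]
    simp
  exact dist_le_zero.1 (ge_of_tendsto' (tendsto_pow_atTop_nhds_zero_of_lt_one
    (by norm_num : (0 : ℝ) ≤ 1 / 2) (by norm_num)) h1)

theorem ModelsRV.stoneMap_injective (hM : ModelsRV M) : Function.Injective (stoneMap M) := by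
  intro a b hab
  have key : ∀ v : StoneSpace M, v.1 a = v.1 b := fun v => DFunLike.congr_fun hab v
  have h1 : a ∸ b = RVOps.zero := hM.eq_zero_of_forall_stoneSpace _ fun v => by
    rw [v.2.map_dotminus, key]
    ext
    simp
  have h2 : b ∸ a = RVOps.zero := hM.eq_zero_of_forall_stoneSpace _ fun v => by
    rw [v.2.map_dotminus, key]
    ext
    simp
  rw [← dist_eq_zero, hM.rv3, h1, h2, E_zero, add_zero]

end Models

/-! ### Topology of the Stone space -/

section StoneSpace

variable (S : Type*) [ContLogic S]

theorem isClosed_setOf_isLogicHom : IsClosed {v : S → unitInterval | IsLogicHom v} := by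
  have : {v : S → unitInterval | IsLogicHom v} =
      ⋂ (i : Fin 3) (x : S) (y : S), {v | v (connective i x y) = connective i (v x) (v y)} := by
    ext v
    simp only [Set.mem_ofPred_eq, Set.mem_iInter]
    exact ⟨fun h => h.map_connective, IsLogicHom.of_map_connective⟩
  rw [this]
  refine isClosed_iInter fun i => isClosed_iInter fun x => isClosed_iInter fun y => ?_
  have h0 : Continuous fun v : S → unitInterval => (v x, v y) := by fun_prop
  exact isClosed_eq (continuous_apply _) ((continuous_connective i).comp h0)

instance : CompactSpace (StoneSpace S) :=
  isCompact_iff_compactSpace.1 (isClosed_setOf_isLogicHom S).isCompact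

instance : T2Space (StoneSpace S) :=
  inferInstanceAs (T2Space {v : S → unitInterval // IsLogicHom v})

theorem isLogicHom_stoneMap : IsLogicHom (stoneMap S) where
  map_neg x := ContinuousMap.ext fun v => v.2.map_neg x
  map_half x := ContinuousMap.ext fun v => v.2.map_half x
  map_dotminus x y := ContinuousMap.ext fun v => v.2.map_dotminus x y

end StoneSpace

/-! ### A Stone–Weierstrass theorem for the connectives -/

section ContinuousFunctions

variable {X : Type*} [TopologicalSpace X]

@[simp] theorem neg_apply (f : C(X, unitInterval)) (x : X) : neg f x = neg (f x) := rfl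

@[simp] theorem half_apply (f : C(X, unitInterval)) (x : X) : half f x = half (f x) := rfl

@[simp] theorem dotminus_apply (f g : C(X, unitInterval)) (x : X) : (f ∸ g) x = f x ∸ g x := rfl

theorem meet_apply (f g : C(X, unitInterval)) (x : X) : meet f g x = meet (f x) (g x) := rfl

/-- A set stable under the connectives. -/
structure IsSublogic {T : Type*} [ContLogic T] (R : Set T) : Prop where
  neg_mem : ∀ f ∈ R, neg f ∈ R
  half_mem : ∀ f ∈ R, half f ∈ R
  dotminus_mem : ∀ f ∈ R, ∀ g ∈ R, f ∸ g ∈ R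

theorem IsLogicHom.isSublogic_range {S T : Type*} [ContLogic S] [ContLogic T] {f : S → T}
    (hf : IsLogicHom f) : IsSublogic (Set.range f) where
  neg_mem := by
    rintro _ ⟨x, rfl⟩
    exact ⟨_, hf.map_neg x⟩
  half_mem := by
    rintro _ ⟨x, rfl⟩
    exact ⟨_, hf.map_half x⟩
  dotminus_mem := by
    rintro _ ⟨x, rfl⟩ _ ⟨y, rfl⟩
    exact ⟨_, hf.map_dotminus x y⟩

/-- Truncation to the unit interval of real valued continuous functions. -/
noncomputable def clamp (f : C(X, ℝ)) : C(X, unitInterval) :=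
  (⟨Set.projIcc 0 1 zero_le_one, continuous_projIcc⟩ : C(ℝ, unitInterval)).comp f

theorem coe_clamp_apply (f : C(X, ℝ)) (x : X) : (clamp f x : ℝ) = max 0 (min 1 (f x)) :=
  Set.coe_projIcc 0 1 zero_le_one (f x)

theorem continuous_clamp : Continuous (clamp : C(X, ℝ) → C(X, unitInterval)) :=
  ContinuousMap.continuous_postcomp _

/-- The underlying real valued function. -/
def toReal (f : C(X, unitInterval)) : C(X, ℝ) := ⟨fun x => f x, by fun_prop⟩

@[simp] theorem toReal_apply (f : C(X, unitInterval)) (x : X) : toReal f x = f x := rfl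

theorem clamp_toReal (f : C(X, unitInterval)) : clamp (toReal f) = f := by
  ext x
  rw [coe_clamp_apply, toReal_apply, min_eq_right (f x).2.2, max_eq_right (f x).2.1]

theorem toReal_clamp {f : C(X, ℝ)} (h0 : ∀ x, 0 ≤ f x) (h1 : ∀ x, f x ≤ 1) :
    toReal (clamp f) = f := by
  ext x
  rw [toReal_apply, coe_clamp_apply, min_eq_right (h1 x), max_eq_right (h0 x)]

variable {R : Set C(X, unitInterval)}

/-- Binary expansion: `½c` and `¬½¬c = (1 + c)/2` prepend a digit and halve the error. The start is
`0 = f ∸ f`, with error at most `1`. -/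
theorem IsSublogic.exists_const_approx (hR : IsSublogic R) (hne : R.Nonempty) (n : ℕ) :
    ∀ r : unitInterval, ∃ c : unitInterval, ContinuousMap.const X c ∈ R ∧
      |(r : ℝ) - c| ≤ (1 / 2) ^ n := by
  obtain ⟨f, hf⟩ := hne
  induction n with
  | zero =>
    intro r
    refine ⟨0, ?_, ?_⟩
    · convert hR.dotminus_mem f hf f hf using 1
      ext x
      simp
    · have := r.2
      simpa [abs_of_nonneg this.1] using this.2
  | succ n ih =>
    intro r
    rcases le_total (r : ℝ) (1 / 2) with hr | hr
    · obtain ⟨c, hc, h⟩ := ih ⟨2 * r, by linarith [r.2.1], by linarith⟩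
      refine ⟨half c, hR.half_mem _ hc, ?_⟩
      rw [abs_le] at h ⊢
      simp only [coe_half, pow_succ] at h ⊢
      constructor <;> linarith [h.1, h.2]
    · obtain ⟨c, hc, h⟩ := ih ⟨2 * r - 1, by linarith, by linarith [r.2.2]⟩
      refine ⟨neg (half (neg c)), hR.neg_mem _ (hR.half_mem _ (hR.neg_mem _ hc)), ?_⟩
      rw [abs_le] at h ⊢
      simp only [coe_half, coe_neg, pow_succ] at h ⊢
      constructor <;> linarith [h.1, h.2]

theorem IsSublogic.const_mem (hR : IsSublogic R) (hne : R.Nonempty) (hcl : IsClosed R)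
    (r : unitInterval) : ContinuousMap.const X r ∈ R := by
  have hcl' : IsClosed {c : unitInterval | ContinuousMap.const X c ∈ R} :=
    hcl.preimage ContinuousMap.continuous_const'
  refine hcl'.closure_subset_iff.2 subset_rfl (Metric.mem_closure_iff.2 fun ε hε => ?_)
  obtain ⟨n, hn⟩ := exists_pow_lt_of_lt_one hε (by norm_num : (1 / 2 : ℝ) < 1)
  obtain ⟨c, hc, h⟩ := hR.exists_const_approx hne n r
  exact ⟨c, hc, by rw [Subtype.dist_eq, Real.dist_eq]; exact h.trans_lt hn⟩

/-- Truncation is monotone, so it commutes with minima, and the minimum is `meet`. Maxima follow by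
De Morgan. -/
theorem IsSublogic.clamp_inf_mem (hR : IsSublogic R) {f g : C(X, ℝ)} (hf : clamp f ∈ R)
    (hg : clamp g ∈ R) : clamp (f ⊓ g) ∈ R := by
  convert hR.dotminus_mem _ hf _ (hR.dotminus_mem _ hf _ hg) using 1
  change _ = meet (clamp f) (clamp g)
  ext x
  rw [meet_apply, coe_meet, coe_clamp_apply, coe_clamp_apply, coe_clamp_apply,
    ContinuousMap.inf_apply, ← max_min_distrib_left, min_comm (f x), inf_inf_distrib_left]

theorem IsSublogic.clamp_sup_mem (hR : IsSublogic R) {f g : C(X, ℝ)} (hf : clamp f ∈ R)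
    (hg : clamp g ∈ R) : clamp (f ⊔ g) ∈ R := by
  have hf' := hR.neg_mem _ hf
  have hg' := hR.neg_mem _ hg
  convert hR.neg_mem _ (hR.dotminus_mem _ hf' _ (hR.dotminus_mem _ hf' _ hg')) using 1
  change _ = neg (meet (neg (clamp f)) (neg (clamp g)))
  ext x
  rw [neg_apply, meet_apply, coe_neg, coe_meet, neg_apply, neg_apply, coe_neg, coe_neg,
    coe_clamp_apply, coe_clamp_apply, coe_clamp_apply, ContinuousMap.sup_apply,
    min_sub_sub_left, sub_sub_cancel, max_comm (f x), min_max_distrib_left, sup_sup_distrib_left]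

/-- Doubling is available up to truncation: `¬(¬s ∸ s) = min 1 (2s)` on `[0,1]`. Iterating makes a
difference arbitrarily steep. -/
theorem IsSublogic.clamp_two_pow_smul_mem (hR : IsSublogic R) {f g : C(X, unitInterval)}
    (hf : f ∈ R) (hg : g ∈ R) (k : ℕ) :
    clamp ((2 : ℝ) ^ k • (toReal f - toReal g)) ∈ R := by
  induction k with
  | zero =>
    convert hR.dotminus_mem f hf g hg using 1
    ext x
    have := (f x).2
    have := (g x).2
    rw [coe_clamp_apply]
    simp only [pow_zero, one_smul, ContinuousMap.sub_apply, toReal_apply, dotminus_apply,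
      coe_dotminus]
    rw [min_eq_right (by linarith [(f x).2.2, (g x).2.1]), max_comm]
  | succ k ih =>
    have ih' := hR.neg_mem _ ih
    convert hR.neg_mem _ (hR.dotminus_mem _ ih' _ ih) using 1
    ext x
    simp only [neg_apply, dotminus_apply, coe_neg, coe_dotminus, coe_clamp_apply, pow_succ,
      ContinuousMap.smul_apply, smul_eq_mul]
    set t := (toReal f - toReal g) x
    rw [mul_comm ((2 : ℝ) ^ k) 2, mul_assoc]
    set s := (2 : ℝ) ^ k * t
    rcases le_total s 0 with h0 | h0
    · rw [min_eq_right (by linarith), min_eq_right (by linarith), max_eq_left (by linarith : 2 * s ≤ 0),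
        max_eq_left h0]
      norm_num
    rcases le_total s 1 with h1 | h1
    · rw [min_eq_right h1, max_eq_right h0]
      rcases le_total (2 * s) 1 with h2 | h2
      · rw [min_eq_right h2, max_eq_right (by linarith), max_eq_left (by linarith)]
        ring
      · rw [min_eq_left h2, max_eq_right (by linarith), max_eq_right (by linarith)]
        ring
    · rw [min_eq_left h1, min_eq_left (by linarith)]
      norm_num

theorem IsSublogic.eq_univ_of_separates [CompactSpace X] (hR : IsSublogic R) (hne : R.Nonempty)
    (hcl : IsClosed R) (hsep : ∀ x y : X, x ≠ y → ∃ f ∈ R, f x ≠ f y) : R = Set.univ := by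
  -- Membership in `L` only sees the truncation, so its members may take arbitrarily large values;
  -- this is what makes interpolation of prescribed reals possible.
  let L : Set C(X, ℝ) := {f | clamp f ∈ R}
  have hconst : ∀ r : ℝ, ContinuousMap.const X r ∈ L := fun r =>
    hR.const_mem hne hcl (Set.projIcc 0 1 zero_le_one r)
  have hinf : ∀ f ∈ L, ∀ g ∈ L, f ⊓ g ∈ L := fun f hf g hg => hR.clamp_inf_mem hf hg
  have hsup : ∀ f ∈ L, ∀ g ∈ L, f ⊔ g ∈ L := fun f hf g hg => hR.clamp_sup_mem hf hg
  have hlow : ∀ x y : X, (∃ f ∈ R, f x < f y) → ∀ p q : ℝ, ∃ f ∈ L, f x ≤ p ∧ q ≤ f y := by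
    rintro x y ⟨f, hf, hxy⟩ p q
    have hlt : (f x : ℝ) < f y := hxy
    -- Subtracting the midpoint of the two values makes the signs at `x` and `y` opposite;
    -- steepening then pushes the values below `p` and above `q`.
    let c : unitInterval := ⟨((f x : ℝ) + f y) / 2,
      by linarith [(f x).2.1, (f y).2.1], by linarith [(f x).2.2, (f y).2.2]⟩
    obtain ⟨k, hk⟩ := pow_unbounded_of_one_lt ((|p| + |q|) / (((f y : ℝ) - f x) / 2)) one_lt_two
    rw [div_lt_iff₀ (by linarith)] at hk
    refine ⟨_, hR.clamp_two_pow_smul_mem hf (hR.const_mem hne hcl c) k, ?_, ?_⟩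
    · simp only [ContinuousMap.smul_apply, ContinuousMap.sub_apply, toReal_apply, smul_eq_mul,
        ContinuousMap.const_apply, c]
      linarith [neg_abs_le p, abs_nonneg q]
    · simp only [ContinuousMap.smul_apply, ContinuousMap.sub_apply, toReal_apply, smul_eq_mul,
        ContinuousMap.const_apply, c]
      linarith [le_abs_self q, abs_nonneg p]
  have hlow' : ∀ x y : X, x ≠ y → ∀ p q : ℝ, ∃ f ∈ L, f x ≤ p ∧ q ≤ f y := by
    intro x y hxy
    obtain ⟨f, hf, hne⟩ := hsep x y hxy
    rcases hne.lt_or_gt with h | h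
    · exact hlow x y ⟨f, hf, h⟩
    · refine hlow x y ⟨_, hR.neg_mem f hf, ?_⟩
      change 1 - (f x : ℝ) < 1 - f y
      have : (f y : ℝ) < f x := h
      linarith
  have hinter : ∀ x y : X, x ≠ y → ∀ p q : ℝ, p ≤ q → ∃ f ∈ L, f x = p ∧ f y = q := by
    intro x y hxy p q hpq
    obtain ⟨f, hf, hx, hy⟩ := hlow' x y hxy p q
    refine ⟨_, hsup _ (hconst p) _ (hinf _ (hconst q) _ hf), ?_, ?_⟩
    · simp [hx]
    · simp [hy, hpq]
  have hL : closure L = ⊤ := by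
    refine ContinuousMap.sublattice_closure_eq_top L ⟨_, hconst 0⟩ hinf hsup fun v x y => ?_
    rcases eq_or_ne x y with rfl | hxy
    · exact ⟨_, hconst (v x), rfl, rfl⟩
    rcases le_total (v x) (v y) with h | h
    · exact hinter x y hxy _ _ h
    · obtain ⟨f, hf, h1, h2⟩ := hinter y x hxy.symm _ _ h
      exact ⟨f, hf, h2, h1⟩
  have hLcl : IsClosed L := hcl.preimage continuous_clamp
  rw [hLcl.closure_eq] at hL
  refine Set.eq_univ_of_forall fun f => ?_
  have : toReal f ∈ L := by rw [hL]; trivial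
  rwa [← clamp_toReal f]

end ContinuousFunctions

/-! ### Bijectivity of `stoneMap` -/

section Models

variable {M : Type*} [MetricSpace M] [RVStructure M]

/-- Unlike in the term algebra, `0 = 0 ∸ 0` holds in a model, which forces the value. -/
theorem ModelsRV.coe_stoneSpace_zero (hM : ModelsRV M) (v : StoneSpace M) :
    v.1 RVOps.zero = 0 := by
  rw [← hM.dotminus_self RVOps.zero, v.2.map_dotminus]
  ext
  simp

theorem ModelsRV.coe_apply_half_iterate_one (hM : ModelsRV M) (v : StoneSpace M) (k : ℕ) :
    (v.1 (half^[k] (one M)) : ℝ) = (1 / 2) ^ k := by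
  rw [v.2.coe_half_iterate, one, v.2.map_neg, hM.coe_stoneSpace_zero]
  simp

theorem ModelsRV.dotminus_eq_zero_iff (hM : ModelsRV M) (x y : M) :
    x ∸ y = RVOps.zero ↔ ∀ v : StoneSpace M, (v.1 x : ℝ) ≤ v.1 y := by
  constructor
  · intro h v
    have := congrArg v.1 h
    rw [hM.coe_stoneSpace_zero, v.2.map_dotminus, Subtype.ext_iff, coe_dotminus] at this
    have h2 := le_max_left ((v.1 x : ℝ) - v.1 y) 0
    rw [this] at h2
    simpa using h2
  · intro h
    refine hM.eq_zero_of_forall_stoneSpace _ fun v => ?_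
    rw [v.2.map_dotminus]
    ext
    simpa using h v

theorem ModelsRV.E_le_of_forall_le (hM : ModelsRV M) {x : M} {k : ℕ}
    (h : ∀ v : StoneSpace M, (v.1 x : ℝ) ≤ (1 / 2) ^ k) : E x ≤ (1 / 2) ^ k := by
  rw [← hM.E_half_iterate_one k]
  refine hM.E_le_of_dotminus_eq_zero ((hM.dotminus_eq_zero_iff _ _).2 fun v => ?_)
  rw [hM.coe_apply_half_iterate_one]
  exact h v

theorem ModelsRV.isClosed_range_stoneMap (hM : ModelsRV M) :
    IsClosed (Set.range (stoneMap M)) := by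
  refine isClosed_of_closure_subset fun f hf => ?_
  -- The exponent `n + 1` makes two approximants differ by at most `2⁻ⁿ`.
  have happ : ∀ n : ℕ, ∃ a : M, ∀ v : StoneSpace M, |(f v : ℝ) - v.1 a| ≤ (1 / 2) ^ (n + 1) := by
    intro n
    obtain ⟨_, ⟨a, rfl⟩, h⟩ := Metric.mem_closure_iff.1 hf ((1 / 2) ^ (n + 1)) (by positivity)
    refine ⟨a, fun v => ?_⟩
    have := (ContinuousMap.dist_apply_le_dist (f := f) (g := stoneMap M a) v).trans h.le
    rwa [Subtype.dist_eq, Real.dist_eq] at this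
  choose a ha using happ
  have hdiff : ∀ n m : ℕ, n ≤ m → ∀ v : StoneSpace M,
      |(v.1 (a n) : ℝ) - v.1 (a m)| ≤ (1 / 2) ^ n := by
    intro n m hnm v
    have h1 := abs_le.1 (ha n v)
    have h2 := abs_le.1 (ha m v)
    have h3 : (1 / 2 : ℝ) ^ (m + 1) ≤ (1 / 2) ^ (n + 1) :=
      pow_le_pow_of_le_one (by norm_num) (by norm_num) (by omega)
    rw [pow_succ (1 / 2 : ℝ) n] at h1 h3
    rw [abs_le]
    constructor <;> linarith [h1.1, h1.2, h2.1, h2.2]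
  have hmax : ∀ (x y : M) (k : ℕ), (∀ v : StoneSpace M, |(v.1 x : ℝ) - v.1 y| ≤ (1 / 2) ^ k) →
      E (x ∸ y) ≤ (1 / 2) ^ k := by
    refine fun x y k h => hM.E_le_of_forall_le fun v => ?_
    rw [v.2.map_dotminus, coe_dotminus]
    exact max_le ((le_abs_self _).trans (h v)) (by positivity)
  have hcauchy : CauchySeq a := by
    have h2 : Filter.Tendsto (fun n : ℕ => 2 * (1 / 2 : ℝ) ^ n) Filter.atTop (nhds 0) := by
      simpa using (tendsto_pow_atTop_nhds_zero_of_lt_one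
        (by norm_num : (0 : ℝ) ≤ 1 / 2) (by norm_num)).const_mul 2
    refine cauchySeq_of_le_tendsto_0' (fun n => 2 * (1 / 2 : ℝ) ^ n) (fun n m hnm => ?_) h2
    rw [hM.rv3]
    linarith [hmax _ _ _ (hdiff n m hnm),
      hmax (a m) (a n) n fun v => by rw [abs_sub_comm]; exact hdiff n m hnm v]
  have := RVStructure.complete (M := M)
  obtain ⟨b, hb⟩ := cauchySeq_tendsto_of_complete hcauchy
  -- A truth assignment need not be continuous for the metric of `M`, so the bound is written as an
  -- equation in `M`, which passes to the limit by continuity of `∸`, and is then read back.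
  have hlim : ∀ n : ℕ, ∀ v : StoneSpace M, |(v.1 (a n) : ℝ) - v.1 b| ≤ (1 / 2) ^ n := by
    have hdm : Continuous fun p : M × M => p.1 ∸ p.2 :=
      RVStructure.uniformContinuous_dotminus.continuous
    intro n
    have h1 : (a n ∸ b) ∸ half^[n] (one M) = RVOps.zero := by
      refine tendsto_nhds_unique_of_eventuallyEq (hdm.tendsto (a n ∸ b, half^[n] (one M)) |>.comp
        ((((hdm.tendsto (a n, b)).comp
          (tendsto_const_nhds.prodMk_nhds hb))).prodMk_nhds tendsto_const_nhds))
        tendsto_const_nhds ?_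
      filter_upwards [Filter.eventually_ge_atTop n] with m hm
      refine (hM.dotminus_eq_zero_iff _ _).2 fun v => ?_
      rw [hM.coe_apply_half_iterate_one]
      change (v.1 (a n ∸ a m) : ℝ) ≤ _
      rw [v.2.map_dotminus, coe_dotminus]
      exact max_le ((le_abs_self _).trans (hdiff n m hm v)) (by positivity)
    have h2 : (b ∸ a n) ∸ half^[n] (one M) = RVOps.zero := by
      refine tendsto_nhds_unique_of_eventuallyEq (hdm.tendsto (b ∸ a n, half^[n] (one M)) |>.comp
        ((((hdm.tendsto (b, a n)).comp
          (hb.prodMk_nhds tendsto_const_nhds))).prodMk_nhds tendsto_const_nhds))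
        tendsto_const_nhds ?_
      filter_upwards [Filter.eventually_ge_atTop n] with m hm
      refine (hM.dotminus_eq_zero_iff _ _).2 fun v => ?_
      rw [hM.coe_apply_half_iterate_one]
      change (v.1 (a m ∸ a n) : ℝ) ≤ _
      rw [v.2.map_dotminus, coe_dotminus]
      refine max_le ((le_abs_self _).trans ?_) (by positivity)
      rw [abs_sub_comm]
      exact hdiff n m hm v
    intro v
    have h3 := (hM.dotminus_eq_zero_iff _ _).1 h1 v
    have h4 := (hM.dotminus_eq_zero_iff _ _).1 h2 v
    rw [hM.coe_apply_half_iterate_one, v.2.map_dotminus, coe_dotminus] at h3 h4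
    have h5 := (le_max_left _ _).trans h3
    have h6 := (le_max_left _ _).trans h4
    rw [abs_le]
    constructor <;> linarith
  refine ⟨b, ContinuousMap.ext fun v => Subtype.ext ?_⟩
  have hp := tendsto_pow_atTop_nhds_zero_of_lt_one (by norm_num : (0 : ℝ) ≤ 1 / 2) (by norm_num)
  have h1 : Filter.Tendsto (fun n : ℕ => (1 / 2 : ℝ) ^ n + (1 / 2) ^ n) Filter.atTop (nhds 0) := by
    simpa using hp.add hp
  have h2 : |(f v : ℝ) - v.1 b| ≤ 0 := ge_of_tendsto' h1 fun n => by
    have h3 : (1 / 2 : ℝ) ^ (n + 1) ≤ (1 / 2) ^ n :=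
      pow_le_pow_of_le_one (by norm_num) (by norm_num) n.le_succ
    exact (abs_sub_le _ (v.1 (a n) : ℝ) _).trans (add_le_add ((ha n v).trans h3) (hlim n v))
  exact (sub_eq_zero.1 (abs_nonpos_iff.1 h2)).symm

theorem ModelsRV.stoneMap_bijective (hM : ModelsRV M) : Function.Bijective (stoneMap M) := by
  refine ⟨hM.stoneMap_injective, Set.range_eq_univ.1 ?_⟩
  refine (isLogicHom_stoneMap M).isSublogic_range.eq_univ_of_separates
    ⟨_, RVOps.zero, rfl⟩ hM.isClosed_range_stoneMap fun v w hvw => ?_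
  by_contra! h
  exact hvw (Subtype.ext (funext fun a => h _ ⟨a, rfl⟩))

end Models

/-! ### Measures from additive functionals on `C(X,[0,1])` -/

section AdditiveFunctional

variable {X : Type*} [TopologicalSpace X]

/-- A nonnegative normalised functional on `C(X,[0,1])` which is additive where sums are defined. -/
structure IsAdditiveState (e : C(X, unitInterval) → ℝ) : Prop where
  nonneg : ∀ f, 0 ≤ e f
  map_one : e (ContinuousMap.const X 1) = 1
  map_add : ∀ f g h, (∀ x, (h x : ℝ) = f x + g x) → e h = e f + e g

namespace IsAdditiveState

variable {e : C(X, unitInterval) → ℝ}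

/-- The affine change of variables from `[-2ᵏ, 2ᵏ]` to `[0, 1]`. -/
noncomputable def rescale (k : ℕ) (f : C(X, ℝ)) : C(X, unitInterval) :=
  clamp (((2 : ℝ) ^ (k + 1))⁻¹ • (f + ContinuousMap.const X (2 ^ k)))

theorem coe_rescale_apply {k : ℕ} {f : C(X, ℝ)} {x : X} (hf : |f x| ≤ 2 ^ k) :
    (rescale k f x : ℝ) = (f x + 2 ^ k) / 2 ^ (k + 1) := by
  rw [rescale, coe_clamp_apply]
  simp only [ContinuousMap.smul_apply, ContinuousMap.add_apply, ContinuousMap.const_apply,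
    smul_eq_mul, inv_mul_eq_div]
  rw [abs_le] at hf
  rw [min_eq_right, max_eq_right]
  · exact div_nonneg (by linarith) (by positivity)
  · rw [div_le_one (by positivity), pow_succ]
    linarith

theorem map_half (he : IsAdditiveState e) (f : C(X, unitInterval)) : e (half f) = e f / 2 := by
  have := he.map_add (half f) (half f) f fun x => by
    rw [half_apply, coe_half]
    ring
  linarith

/-- The value at `f` of the extension of `e` does not depend on the scale used to compute it. -/
theorem rescale_succ (he : IsAdditiveState e) {k : ℕ} {f : C(X, ℝ)} (hf : ∀ x, |f x| ≤ 2 ^ k) :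
    2 ^ (k + 2) * e (rescale (k + 1) f) - 2 ^ (k + 1) =
      2 ^ (k + 1) * e (rescale k f) - 2 ^ k := by
  have hf' : ∀ x, |f x| ≤ 2 ^ (k + 1) := fun x => (hf x).trans (by
    rw [pow_succ]
    linarith [pow_pos (two_pos : (0 : ℝ) < 2) k])
  have h1 := he.map_add (half (rescale k f)) (half (half (ContinuousMap.const X 1)))
    (rescale (k + 1) f) fun x => by
      rw [coe_rescale_apply (hf' x), half_apply, half_apply, half_apply, coe_half, coe_half,
        coe_half, coe_rescale_apply (hf x)]
      simp only [ContinuousMap.const_apply, Set.Icc.coe_one, pow_succ]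
      field_simp
      ring
  rw [h1, he.map_half, he.map_half, he.map_half, he.map_one]
  ring

theorem rescale_eq_of_le (he : IsAdditiveState e) {k l : ℕ} (hkl : k ≤ l) {f : C(X, ℝ)}
    (hf : ∀ x, |f x| ≤ 2 ^ k) :
    2 ^ (l + 1) * e (rescale l f) - 2 ^ l = 2 ^ (k + 1) * e (rescale k f) - 2 ^ k := by
  induction l, hkl using Nat.le_induction with
  | base => rfl
  | succ l hl ih =>
    rw [← ih]
    exact he.rescale_succ fun x => (hf x).trans (pow_le_pow_right₀ one_le_two hl)

theorem exists_abs_le_two_pow [CompactSpace X] (f : C(X, ℝ)) : ∃ k : ℕ, ∀ x, |f x| ≤ 2 ^ k := by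
  obtain ⟨k, hk⟩ := pow_unbounded_of_one_lt ‖f‖ one_lt_two
  exact ⟨k, fun x => (f.norm_coe_le_norm x).trans hk.le⟩

/-- At a scale `2ᵏ` bounding `f`, the affine change of variables is undone after applying `e`.
Additivity is checked at a common scale: the rescaling of `f + g` at `k + 1` is the sum of the
halves of the rescalings at `k`. -/
theorem exists_additive_extension [CompactSpace X] (he : IsAdditiveState e) :
    ∃ Λ : C(X, ℝ) →+ ℝ, ∀ (k : ℕ) (f : C(X, ℝ)), (∀ x, |f x| ≤ 2 ^ k) →
      Λ f = 2 ^ (k + 1) * e (rescale k f) - 2 ^ k := by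
  choose κ hκ using exists_abs_le_two_pow (X := X)
  let Λ : C(X, ℝ) → ℝ := fun f => 2 ^ (κ f + 1) * e (rescale (κ f) f) - 2 ^ κ f
  have hΛ : ∀ (k : ℕ) (f : C(X, ℝ)), (∀ x, |f x| ≤ 2 ^ k) →
      Λ f = 2 ^ (k + 1) * e (rescale k f) - 2 ^ k := by
    intro k f hf
    rcases le_total k (κ f) with h | h
    · exact he.rescale_eq_of_le h hf
    · exact (he.rescale_eq_of_le h (hκ f)).symm
  refine ⟨AddMonoidHom.mk' Λ fun f g => ?_, hΛ⟩
  let k := max (κ f) (κ g)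
  have hf : ∀ x, |f x| ≤ 2 ^ k := fun x =>
    (hκ f x).trans (pow_le_pow_right₀ one_le_two (le_max_left _ _))
  have hg : ∀ x, |g x| ≤ 2 ^ k := fun x =>
    (hκ g x).trans (pow_le_pow_right₀ one_le_two (le_max_right _ _))
  have hfg : ∀ x, |(f + g) x| ≤ 2 ^ (k + 1) := fun x => by
    rw [pow_succ, ContinuousMap.add_apply]
    linarith [abs_add_le (f x) (g x), hf x, hg x]
  have h1 := he.map_add (half (rescale k f)) (half (rescale k g)) (rescale (k + 1) (f + g))
    fun x => by
      rw [coe_rescale_apply (hfg x), half_apply, half_apply, coe_half,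
        coe_half, coe_rescale_apply (hf x), coe_rescale_apply (hg x)]
      simp only [ContinuousMap.add_apply, pow_succ]
      field_simp
      ring
  rw [hΛ _ _ hf, hΛ _ _ hg, hΛ _ _ hfg, h1, he.map_half, he.map_half]
  ring

/-- A Riesz representation theorem for additive states. -/
theorem exists_regular_measure [CompactSpace X] [T2Space X] [MeasurableSpace X] [BorelSpace X]
    (he : IsAdditiveState e) :
    ∃ μ : Measure X, IsProbabilityMeasure μ ∧ μ.Regular ∧
      ∀ f : C(X, unitInterval), ∫ x, (f x : ℝ) ∂μ = e f := by
  obtain ⟨Λ, hΛ⟩ := he.exists_additive_extension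
  have hval : ∀ f : C(X, unitInterval), Λ (toReal f) = e f := by
    intro f
    have hf : ∀ x, |toReal f x| ≤ 2 ^ 0 := fun x => by
      rw [toReal_apply, abs_of_nonneg (f x).2.1, pow_zero]
      exact (f x).2.2
    have h1 := he.map_add (half f) (half (ContinuousMap.const X 1)) (rescale 0 (toReal f))
      fun x => by
        rw [coe_rescale_apply (hf x), half_apply, half_apply, coe_half, coe_half]
        simp only [toReal_apply, ContinuousMap.const_apply, Set.Icc.coe_one]
        ring
    rw [hΛ _ _ hf, h1, he.map_half, he.map_half, he.map_one]
    ring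
  have hone : Λ 1 = 1 := by
    rw [← he.map_one, ← hval]
    congr 1
  -- For `f ≥ 0` the rescaling is `f / 2ᵏ⁺¹` plus the constant `1/2`, whose contribution cancels
  -- `2ᵏ`.
  have hnonneg : ∀ f : C(X, ℝ), (∀ x, 0 ≤ f x) → 0 ≤ Λ f := by
    intro f hf
    obtain ⟨k, hk⟩ := exists_abs_le_two_pow f
    have hs : ∀ x, 0 ≤ (((2 : ℝ) ^ (k + 1))⁻¹ • f) x := fun x => by
      rw [ContinuousMap.smul_apply, smul_eq_mul]
      exact mul_nonneg (by positivity) (hf x)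
    have hs1 : ∀ x, (((2 : ℝ) ^ (k + 1))⁻¹ • f) x ≤ 1 := fun x => by
      rw [ContinuousMap.smul_apply, smul_eq_mul, inv_mul_eq_div, div_le_one (by positivity),
        pow_succ]
      linarith [le_of_abs_le (hk x), pow_pos (two_pos : (0 : ℝ) < 2) k]
    have h1 := he.map_add (clamp (((2 : ℝ) ^ (k + 1))⁻¹ • f)) (half (ContinuousMap.const X 1))
      (rescale k f) fun x => by
        rw [coe_rescale_apply (hk x), ← toReal_apply (clamp _), toReal_clamp hs hs1]
        simp only [half_apply, coe_half, ContinuousMap.const_apply, Set.Icc.coe_one,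
          ContinuousMap.smul_apply, smul_eq_mul, pow_succ]
        field_simp
    rw [hΛ _ _ hk, h1, he.map_half, he.map_one, pow_succ]
    have := mul_nonneg (by positivity : (0 : ℝ) ≤ 2 ^ k * 2)
      (he.nonneg (clamp (((2 : ℝ) ^ (k + 1))⁻¹ • f)))
    rw [pow_succ] at this
    linarith
  -- Continuity upgrades additivity to real linearity. If `‖f‖ < 2⁻ⁿ`, positivity of `Λ` on `1 ± 2ⁿ
  -- f` bounds `|Λ f|` by `2⁻ⁿ`.
  have hcont : Continuous Λ := by
    refine continuous_of_continuousAt_zero Λ ?_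
    rw [Metric.continuousAt_iff]
    intro ε hε
    obtain ⟨n, hn⟩ := exists_pow_lt_of_lt_one hε (by norm_num : (1 / 2 : ℝ) < 1)
    refine ⟨(1 / 2) ^ n, by positivity, fun {f} hf => ?_⟩
    rw [dist_zero_right] at hf
    rw [map_zero, dist_zero_right, Real.norm_eq_abs]
    refine lt_of_le_of_lt ?_ hn
    have hb : ∀ x, |((2 ^ n : ℕ) • f) x| ≤ 1 := fun x => by
      have := (f.norm_coe_le_norm x).trans hf.le
      rw [ContinuousMap.nsmul_apply, nsmul_eq_mul, abs_mul]
      push_cast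
      rw [abs_of_pos (by positivity : (0 : ℝ) < 2 ^ n)]
      calc (2 : ℝ) ^ n * |f x| ≤ 2 ^ n * (1 / 2) ^ n := by gcongr; exact this
        _ = 1 := by rw [← mul_pow]; norm_num
    have h1 := hnonneg (1 - (2 ^ n : ℕ) • f) fun x => by
      have := (abs_le.1 (hb x)).2
      rw [ContinuousMap.sub_apply, ContinuousMap.one_apply]
      linarith
    have h2 := hnonneg (1 + (2 ^ n : ℕ) • f) fun x => by
      have := (abs_le.1 (hb x)).1
      rw [ContinuousMap.add_apply, ContinuousMap.one_apply]
      linarith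
    rw [map_sub, hone, map_nsmul, nsmul_eq_mul] at h1
    rw [_root_.map_add, hone, map_nsmul, nsmul_eq_mul] at h2
    push_cast at h1 h2
    rw [one_div, inv_pow, ← one_div, le_div_iff₀ (by positivity),
      ← abs_of_pos (by positivity : (0 : ℝ) < 2 ^ n), ← abs_mul, abs_le]
    constructor <;> linarith
  let Λ' : CompactlySupportedContinuousMap X ℝ →ₚ[ℝ] ℝ :=
    { toFun := fun f => Λ f.toContinuousMap
      map_add' := fun f g => _root_.map_add Λ f.toContinuousMap g.toContinuousMap
      map_smul' := fun c f => map_real_smul Λ hcont c f.toContinuousMap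
      monotone' := fun f g hfg => by
        have := hnonneg (g.toContinuousMap - f.toContinuousMap) fun x => sub_nonneg.2 (hfg x)
        rw [map_sub] at this
        exact sub_nonneg.1 this }
  have hint : ∀ f : C(X, unitInterval), ∫ x, (f x : ℝ) ∂(RealRMK.rieszMeasure Λ') = e f := by
    intro f
    rw [← hval]
    exact RealRMK.integral_rieszMeasure Λ' ⟨toReal f, HasCompactSupport.of_compactSpace _⟩
  refine ⟨RealRMK.rieszMeasure Λ', ⟨?_⟩, inferInstance, hint⟩
  have := hint (ContinuousMap.const X 1)
  rw [he.map_one] at this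
  simpa [measureReal_def, ENNReal.toReal_eq_one_iff] using this

end IsAdditiveState

/-- Every continuous real function is an affine image of a `[0,1]`-valued one, and regular measures
are determined by integrals of continuous functions. -/
theorem measure_eq_of_forall_integral_eq [CompactSpace X] [T2Space X] [MeasurableSpace X]
    [BorelSpace X] {μ ν : Measure X} [IsProbabilityMeasure μ] [IsProbabilityMeasure ν]
    (hμ : μ.Regular) (hν : ν.Regular)
    (h : ∀ f : C(X, unitInterval), ∫ x, (f x : ℝ) ∂μ = ∫ x, (f x : ℝ) ∂ν) : μ = ν := by
  refine Measure.ext_of_integral_eq_on_compactlySupported fun g => ?_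
  obtain ⟨k, hk⟩ := IsAdditiveState.exists_abs_le_two_pow g.toContinuousMap
  let f := IsAdditiveState.rescale k g.toContinuousMap
  have hg : ∀ x, g x = 2 ^ (k + 1) * (f x : ℝ) - 2 ^ k := fun x => by
    rw [IsAdditiveState.coe_rescale_apply (hk x)]
    field_simp
    exact (add_sub_cancel_right _ _).symm
  have hi : ∀ ρ : Measure X, IsProbabilityMeasure ρ →
      ∫ x, g x ∂ρ = 2 ^ (k + 1) * ∫ x, (f x : ℝ) ∂ρ - 2 ^ k := fun ρ hρ => by
    have : Integrable (fun x => (f x : ℝ)) ρ :=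
      (toReal f).continuous.integrable_of_hasCompactSupport (HasCompactSupport.of_compactSpace _)
    simp_rw [hg]
    rw [integral_sub (this.const_mul _) (integrable_const _), integral_const_mul]
    simp
  rw [hi μ inferInstance, hi ν inferInstance, h]

end AdditiveFunctional

/-! ### Spaces of random variables are models of `RV` -/

section L1I

variable {Ω : Type*} [MeasurableSpace Ω] {μ : Measure Ω}

namespace L1I

theorem ext_ae {f g : L1I μ} (h : f.1 =ᵐ[μ] g.1) : f = g := Subtype.ext (Lp.ext h)

theorem integrable (f : L1I μ) : Integrable f.1 μ := L1.integrable_coeFn f.1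

theorem dist_eq (f g : L1I μ) : dist f g = ∫ ω, |f.1 ω - g.1 ω| ∂μ := by
  rw [Subtype.dist_eq, L1.dist_eq_integral_dist]
  rfl

variable [IsProbabilityMeasure μ]

variable (μ) in
theorem coeFn_zero : ((RVOps.zero : L1I μ).1 : Ω → ℝ) =ᵐ[μ] fun _ => 0 := Lp.coeFn_zero ℝ 1 μ

theorem coeFn_neg (f : L1I μ) : (neg f).1 =ᵐ[μ] fun ω => 1 - f.1 ω := by
  filter_upwards [Lp.coeFn_sub (Lp.const 1 μ (1 : ℝ)) f.1, Lp.coeFn_const 1 μ (1 : ℝ)] with ω h h1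
  change (Lp.const 1 μ (1 : ℝ) - f.1) ω = _
  rw [h, Pi.sub_apply, h1]
  rfl

theorem coeFn_half (f : L1I μ) : (half f).1 =ᵐ[μ] fun ω => f.1 ω / 2 := by
  filter_upwards [Lp.coeFn_smul (1 / 2 : ℝ) f.1] with ω h
  change ((1 / 2 : ℝ) • f.1) ω = _
  rw [h, Pi.smul_apply, smul_eq_mul]
  ring

theorem coeFn_dotminus (f g : L1I μ) : (f ∸ g).1 =ᵐ[μ] fun ω => max (f.1 ω - g.1 ω) 0 := by
  filter_upwards [Lp.coeFn_sup (f.1 - g.1) 0, Lp.coeFn_sub f.1 g.1, Lp.coeFn_zero ℝ 1 μ]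
    with ω h h1 h0
  change ((f.1 - g.1) ⊔ 0 : Lp ℝ 1 μ) ω = _
  rw [h, Pi.sup_apply, h1, h0]
  rfl

theorem coeFn_meet (f g : L1I μ) : (meet f g).1 =ᵐ[μ] fun ω => min (g.1 ω) (f.1 ω) := by
  filter_upwards [coeFn_dotminus f (f ∸ g), coeFn_dotminus f g, f.2, g.2] with ω h h1 hf hg
  rw [meet, h, h1]
  exact coe_meet ⟨_, hf⟩ ⟨_, hg⟩

theorem E_eq (f : L1I μ) : E f = ∫ ω, f.1 ω ∂μ := by
  rw [E, dist_eq]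
  refine integral_congr_ae ?_
  filter_upwards [coeFn_zero μ, f.2] with ω h hf
  rw [h, sub_zero, abs_of_nonneg hf.1]

theorem E_eq_of_ae {f : L1I μ} {F : Ω → ℝ} (h : f.1 =ᵐ[μ] F) : E f = ∫ ω, F ω ∂μ :=
  (E_eq f).trans (integral_congr_ae h)

end L1I

variable [IsProbabilityMeasure μ]

noncomputable instance : RVOps unitInterval where
  zero := 0

theorem isLogicHom_eval (b : ℕ → unitInterval) : IsLogicHom (RVTerm.eval b) :=
  ⟨fun _ => rfl, fun _ => rfl, fun _ _ => rfl⟩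

/-- Reduces validity in `L¹` to validity in `[0,1]`: for each `ω`, evaluating terms at the values at
`ω` is a truth assignment. The projection only corrects a null set. -/
theorem L1I.coeFn_eval (a : ℕ → L1I μ) (τ : RVTerm) : (τ.eval a).1 =ᵐ[μ] fun ω =>
    ((τ.eval fun n => Set.projIcc 0 1 zero_le_one ((a n).1 ω) : unitInterval) : ℝ) := by
  induction τ with
  | var n =>
    filter_upwards [(a n).2] with ω h
    simp only [RVTerm.eval]
    rw [Set.projIcc_of_mem _ h]
  | zero => exact L1I.coeFn_zero μ
  | neg τ ih =>
    filter_upwards [L1I.coeFn_neg (τ.eval a), ih] with ω h h1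
    simp only [RVTerm.eval]
    rw [h, h1, coe_neg]
  | half τ ih =>
    filter_upwards [L1I.coeFn_half (τ.eval a), ih] with ω h h1
    simp only [RVTerm.eval]
    rw [h, h1, coe_half]
  | dotminus τ σ ih ih' =>
    filter_upwards [L1I.coeFn_dotminus (τ.eval a) (σ.eval a), ih, ih'] with ω h h1 h2
    simp only [RVTerm.eval]
    rw [h, h1, h2, coe_dotminus]

variable (μ) in
theorem L1I.modelsRV : ModelsRV (L1I μ) where
  rv1 f g := by
    rw [L1I.E_eq, L1I.E_eq, L1I.E_eq, ← integral_add (L1I.integrable _) (L1I.integrable _)]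
    refine integral_congr_ae ?_
    filter_upwards [L1I.coeFn_dotminus f g, L1I.coeFn_meet g f] with ω h1 h2
    rw [h1, h2]
    rcases le_total (f.1 ω) (g.1 ω) with h | h
    · rw [max_eq_right (by linarith), min_eq_left h, zero_add]
    · rw [max_eq_left (by linarith), min_eq_right h, sub_add_cancel]
  rv2 := by
    have : (one (L1I μ)).1 =ᵐ[μ] fun _ => (1 : ℝ) := by
      filter_upwards [L1I.coeFn_neg (RVOps.zero : L1I μ), L1I.coeFn_zero μ] with ω h h0
      rw [one, h, h0, sub_zero]
    rw [L1I.E_eq_of_ae this]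
    simp
  rv3 f g := by
    rw [L1I.dist_eq, L1I.E_eq, L1I.E_eq, ← integral_add (L1I.integrable _) (L1I.integrable _)]
    refine integral_congr_ae ?_
    filter_upwards [L1I.coeFn_dotminus f g, L1I.coeFn_dotminus g f] with ω h1 h2
    rw [h1, h2]
    rcases le_total (f.1 ω) (g.1 ω) with h | h
    · rw [max_eq_right (by linarith), max_eq_left (by linarith), abs_of_nonpos (by linarith)]
      ring
    · rw [max_eq_left (by linarith), max_eq_right (by linarith), abs_of_nonneg (by linarith)]
      ring
  rv4 τ hτ a := by
    refine L1I.ext_ae ?_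
    filter_upwards [L1I.coeFn_eval a τ, L1I.coeFn_zero μ] with ω h h0
    rw [h, h0]
    exact congrArg Subtype.val (hτ ⟨_, isLogicHom_eval _⟩)

end L1I

/-! ### The natural map from continuous functions to random variables -/

section Rho

variable {X : Type*} [TopologicalSpace X] [MeasurableSpace X] [BorelSpace X]
  (μ : Measure X) [IsProbabilityMeasure μ]

theorem coeFn_rho (f : C(X, unitInterval)) : (rho μ f).1 =ᵐ[μ] fun x => (f x : ℝ) :=
  MemLp.coeFn_toLp (MemLp.of_bound (toReal f).continuous.aestronglyMeasurable 1
    (Filter.Eventually.of_forall fun x => by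
      rw [Real.norm_eq_abs, toReal_apply, abs_of_nonneg (f x).2.1]
      exact (f x).2.2))

theorem isLogicHom_rho : IsLogicHom (rho μ) where
  map_neg f := by
    refine L1I.ext_ae ?_
    filter_upwards [coeFn_rho μ f, coeFn_rho μ (neg f), L1I.coeFn_neg (rho μ f)] with x h1 h2 h3
    rw [h2, h3, h1, neg_apply, coe_neg]
  map_half f := by
    refine L1I.ext_ae ?_
    filter_upwards [coeFn_rho μ f, coeFn_rho μ (half f), L1I.coeFn_half (rho μ f)] with x h1 h2 h3
    rw [h2, h3, h1, half_apply, coe_half]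
  map_dotminus f g := by
    refine L1I.ext_ae ?_
    filter_upwards [coeFn_rho μ f, coeFn_rho μ g, coeFn_rho μ (f ∸ g),
      L1I.coeFn_dotminus (rho μ f) (rho μ g)] with x h1 h2 h3 h4
    rw [h3, h4, h1, h2, dotminus_apply, coe_dotminus]

theorem E_rho (f : C(X, unitInterval)) : E (rho μ f) = ∫ x, (f x : ℝ) ∂μ :=
  L1I.E_eq_of_ae (coeFn_rho μ f)

/-- Truncation is 1-Lipschitz and fixes values in `[0,1]`, so truncating a continuous `L¹`
approximant brings it no further from `g`. -/
theorem denseRange_rho [CompactSpace X] [T2Space X] [μ.Regular] : DenseRange (rho μ) := by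
  intro g
  rw [Metric.mem_closure_iff]
  intro ε hε
  obtain ⟨_, ⟨F, rfl⟩, hF⟩ := Metric.mem_closure_iff.1
    (ContinuousMap.toLp_denseRange (p := 1) ℝ μ ℝ ENNReal.one_ne_top g.1) ε hε
  refine ⟨_, ⟨clamp F, rfl⟩, lt_of_le_of_lt ?_ hF⟩
  rw [L1I.dist_eq, L1.dist_eq_integral_dist]
  refine integral_mono_ae ((L1I.integrable g).sub (L1I.integrable _)).abs
    ((L1I.integrable g).sub (L1.integrable_coeFn _)).norm ?_
  filter_upwards [coeFn_rho μ (clamp F), ContinuousMap.coeFn_toLp (p := 1) (𝕜 := ℝ) μ F, g.2]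
    with x h1 h2 hg
  rw [h1, h2, Real.dist_eq]
  have h := Set.abs_projIcc_sub_projIcc (c := g.1 x) (d := F x) (zero_le_one (α := ℝ))
  rw [Set.projIcc_of_mem _ hg] at h
  exact h

end Rho

/-! ### The representation of a model on its Stone space -/

section Models

variable {M : Type*} [MetricSpace M] [RVStructure M]

theorem IsRVIso.E_map {N : Type*} [MetricSpace N] [RVStructure N] {f : M → N} (hf : IsRVIso f)
    (a : M) : E (f a) = E a := by
  rw [E, ← hf.map_zero, hf.isometry.dist_eq, E]

theorem ModelsRV.exists_isBasedOn (hM : ModelsRV M) :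
    ∃ (μ : Measure (StoneSpace M)) (_ : IsProbabilityMeasure μ),
      IsBasedOn M (StoneSpace M) μ (stoneMap M) := by
  let θ := Equiv.ofBijective _ hM.stoneMap_bijective
  have hθ : ∀ (f : C(StoneSpace M, unitInterval)) (v : StoneSpace M), v.1 (θ.symm f) = f v :=
    fun f v =>
    DFunLike.congr_fun (θ.apply_symm_apply f) v
  have hθ' : ∀ (f : C(StoneSpace M, unitInterval)) (a : M),
      (∀ v : StoneSpace M, (f v : ℝ) = v.1 a) → θ.symm f = a := fun f a h => by
    rw [Equiv.symm_apply_eq]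
    exact ContinuousMap.ext fun v => Subtype.ext (h v)
  have he : IsAdditiveState fun f => E (θ.symm f) := by
    refine ⟨fun f => E_nonneg _, ?_, fun f g h hfg => ?_⟩
    · rw [hθ' _ (one M), hM.rv2]
      intro v
      rw [one, v.2.map_neg, hM.coe_stoneSpace_zero]
      simp
    -- If `h = f + g`, then `g = h ∸ f` and `f = f ∧ h`, so additivity is exactly `rv1`.
    · have h1 : θ.symm g = θ.symm h ∸ θ.symm f := hθ' _ _ fun v => by
        rw [v.2.map_dotminus, hθ, hθ, coe_dotminus, hfg, add_sub_cancel_left,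
          max_eq_left (g v).2.1]
      have h2 : θ.symm f = meet (θ.symm f) (θ.symm h) := hθ' _ _ fun v => by
        rw [v.2.map_meet, hθ, hθ, coe_meet, hfg, min_eq_right]
        linarith [(g v).2.1]
      change E (θ.symm h) = E (θ.symm f) + E (θ.symm g)
      rw [hM.rv1 (θ.symm h) (θ.symm f), ← h1, ← h2, add_comm]
  obtain ⟨μ, hμ, hreg, hint⟩ := he.exists_regular_measure
  have hE : ∀ a : M, E (rho μ (stoneMap M a)) = E a := fun a => by
    rw [E_rho, hint]
    exact congrArg E (θ.symm_apply_apply a)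
  have hhom : IsLogicHom (rho μ ∘ stoneMap M) := (isLogicHom_rho μ).comp (isLogicHom_stoneMap M)
  have hiso : Isometry (rho μ ∘ stoneMap M) := Isometry.of_dist_eq fun a b => by
    rw [(L1I.modelsRV μ).rv3, hM.rv3, ← hhom.map_dotminus, ← hhom.map_dotminus]
    exact congrArg₂ (· + ·) (hE _) (hE _)
  -- The isometric image of a complete space is closed; as `θ` is onto, it equals the dense range of
  -- `ρ`.
  have hsurj : Function.Surjective (rho μ ∘ stoneMap M) := by
    have := RVStructure.complete (M := M)
    have hcl := hiso.isClosedEmbedding.isClosed_range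
    rw [Set.range_comp, Set.range_eq_univ.2 hM.stoneMap_bijective.2, Set.image_univ] at hcl
    rw [← Set.range_eq_univ, Set.range_comp, Set.range_eq_univ.2 hM.stoneMap_bijective.2,
      Set.image_univ, ← hcl.closure_eq]
    exact (denseRange_rho μ).closure_range
  have hbij : Function.Bijective (rho μ ∘ stoneMap M) := ⟨hiso.injective, hsurj⟩
  have hzero : (rho μ ∘ stoneMap M) RVOps.zero = RVOps.zero := by
    rw [← hM.dotminus_self RVOps.zero, hhom.map_dotminus, (L1I.modelsRV μ).dotminus_self]
  exact ⟨μ, hμ, inferInstance, inferInstance, hM.stoneMap_bijective, isLogicHom_stoneMap M, hreg,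
    (Function.Bijective.of_comp_iff _ hM.stoneMap_bijective).1 hbij, ⟨hhom, hbij, hiso, hzero⟩⟩

theorem integral_eq_E_of_isRVIso {X : Type*} [TopologicalSpace X] [MeasurableSpace X]
    [BorelSpace X] {ν : Measure X} [IsProbabilityMeasure ν] {θ : M → C(X, unitInterval)}
    (h : IsRVIso (rho ν ∘ θ)) (a : M) : ∫ x, (θ a x : ℝ) ∂ν = E a := by
  rw [← E_rho, ← h.E_map]
  rfl

theorem ModelsRV.measure_unique (hM : ModelsRV M) {μ ν : Measure (StoneSpace M)}
    [IsProbabilityMeasure μ] [IsProbabilityMeasure ν] (hμ : μ.Regular) (hν : ν.Regular)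
    (h : ∀ a, ∫ v, (stoneMap M a v : ℝ) ∂μ = E a) (h' : ∀ a, ∫ v, (stoneMap M a v : ℝ) ∂ν = E a) :
    ν = μ := by
  refine measure_eq_of_forall_integral_eq hν hμ fun f => ?_
  obtain ⟨a, rfl⟩ := hM.stoneMap_bijective.2 f
  rw [h, h']

theorem exists_unitInterval_separating {X : Type*} [TopologicalSpace X] [CompactSpace X]
    [T2Space X] {A : Set X} (hA : IsClosed A) {y : X} (hy : y ∉ A) :
    ∃ f : C(X, unitInterval), (∀ x ∈ A, f x = 0) ∧ f y = 1 := by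
  obtain ⟨f, h0, h1, h01⟩ := exists_continuous_zero_one_of_isClosed hA (isClosed_singleton (x := y))
    (Set.disjoint_singleton_right.2 hy)
  refine ⟨⟨fun x => ⟨f x, h01 x⟩, by fun_prop⟩, fun x hx => Subtype.ext (h0 hx),
    Subtype.ext (h1 rfl)⟩

/-- The compatibility condition leaves only `x ↦ (a ↦ θ a x)`. Urysohn functions, all of the form `θ
a` or `θ_M a`, make it bijective, and measure preservation is uniqueness of `μ` applied to the image
of `ν`. -/
theorem ModelsRV.existsUnique_homeomorph (hM : ModelsRV M) {μ : Measure (StoneSpace M)}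
    [IsProbabilityMeasure μ] (hμ : IsBasedOn M (StoneSpace M) μ (stoneMap M))
    {X : Type*} [TopologicalSpace X] [MeasurableSpace X] [BorelSpace X]
    {ν : Measure X} [IsProbabilityMeasure ν] {θ : M → C(X, unitInterval)}
    (hν : IsBasedOn M X ν θ) :
    ∃! h : X ≃ₜ StoneSpace M,
      MeasurePreserving h ν μ ∧ ∀ (a : M) (x : X), stoneMap M a (h x) = θ a x := by
  have := hν.compact
  have := hν.hausdorff
  let g : X → StoneSpace M := fun x => ⟨fun a => θ a x,
    fun a => DFunLike.congr_fun (hν.isLogicHom.map_neg a) x,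
    fun a => DFunLike.congr_fun (hν.isLogicHom.map_half a) x,
    fun a b => DFunLike.congr_fun (hν.isLogicHom.map_dotminus a b) x⟩
  have hg : Continuous g := Continuous.subtype_mk (continuous_pi fun a => (θ a).continuous) _
  have hinj : Function.Injective g := by
    intro x y hxy
    by_contra hne
    obtain ⟨f, h0, h1⟩ := exists_unitInterval_separating (isClosed_singleton (x := x))
      (y := y) (Ne.symm hne)
    obtain ⟨a, rfl⟩ := hν.bijective.2 f
    have h2 : θ a x = θ a y := congrFun (congrArg Subtype.val hxy) a
    rw [h0 x rfl, h1] at h2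
    exact zero_ne_one h2
  have hsurj : Function.Surjective g := by
    intro v
    by_contra hv
    obtain ⟨f, h0, h1⟩ := exists_unitInterval_separating (isCompact_range hg).isClosed
      (y := v) hv
    obtain ⟨a, rfl⟩ := hM.stoneMap_bijective.2 f
    -- A function separating `v` from the range pulls back to zero on `X`, so its `a` is `0`,
    -- contradicting the value `1` at `v`.
    have ha : θ a = θ RVOps.zero := by
      ext x
      have h2 : θ a x = 0 := h0 (g x) ⟨x, rfl⟩
      rw [h2, ← hM.dotminus_self RVOps.zero, hν.isLogicHom.map_dotminus]
      simp
    rw [hν.bijective.1 ha] at h1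
    have h2 : stoneMap M RVOps.zero v = 0 := hM.coe_stoneSpace_zero v
    exact zero_ne_one (h2.symm.trans h1)
  let h : X ≃ₜ StoneSpace M :=
    Continuous.homeoOfEquivCompactToT2 (f := Equiv.ofBijective g ⟨hinj, hsurj⟩) hg
  have hh : ∀ (a : M) (x : X), stoneMap M a (h x) = θ a x := fun _ _ => rfl
  refine ⟨h, ⟨⟨h.measurable, ?_⟩, hh⟩, fun k ⟨_, hk⟩ => ?_⟩
  · have hprob : IsProbabilityMeasure (ν.map h) :=
      Measure.isProbabilityMeasure_map h.measurable.aemeasurable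
    have := hν.regular
    refine hM.measure_unique hμ.regular (Measure.Regular.map h)
      (integral_eq_E_of_isRVIso hμ.isRVIso) fun a => ?_
    rw [← integral_eq_E_of_isRVIso hν.isRVIso,
      integral_map h.measurable.aemeasurable (by
        exact (toReal (stoneMap M a)).continuous.aestronglyMeasurable)]
    rfl
  · refine Homeomorph.ext fun x => Subtype.ext (funext fun a => ?_)
    exact (hk a x).trans (hh a x).symm

end Models

/-! ### Transfer along isomorphisms -/

section Transfer

variable {M N : Type*} [MetricSpace M] [RVStructure M] [MetricSpace N] [RVStructure N] {f : M → N}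

theorem IsRVIso.map_eval (hf : IsRVIso f) (a : ℕ → M) (τ : RVTerm) :
    f (τ.eval a) = τ.eval (f ∘ a) := by
  induction τ with
  | var n => rfl
  | zero => exact hf.map_zero
  | neg τ ih =>
    simp only [RVTerm.eval]
    rw [hf.map_neg, ih]
  | half τ ih =>
    simp only [RVTerm.eval]
    rw [hf.map_half, ih]
  | dotminus τ σ ih ih' =>
    simp only [RVTerm.eval]
    rw [hf.map_dotminus, ih, ih']

theorem IsRVIso.modelsRV (hf : IsRVIso f) (hN : ModelsRV N) : ModelsRV M where
  rv1 x y := by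
    rw [← hf.E_map, ← hf.E_map (x ∸ y), ← hf.E_map (meet y x), hf.map_dotminus,
      hf.toIsLogicHom.map_meet, ← hN.rv1]
  rv2 := by
    rw [← hf.E_map, one, hf.map_neg, hf.map_zero]
    exact hN.rv2
  rv3 x y := by
    rw [← hf.E_map (x ∸ y), ← hf.E_map (y ∸ x), hf.map_dotminus, hf.map_dotminus, ← hN.rv3,
      hf.isometry.dist_eq]
  rv4 τ hτ a := hf.bijective.1 (by rw [hf.map_eval, hN.rv4 τ hτ, hf.map_zero])

theorem IsRVIso.iInf_arv_eq (hf : IsRVIso f) (x : M) :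
    ⨅ y : M, max (E (meet y (neg y))) |E (meet y x) - E x / 2| =
      ⨅ y : N, max (E (meet y (neg y))) |E (meet y (f x)) - E (f x) / 2| := by
  refine hf.bijective.2.iInf_congr f fun y => ?_
  rw [← hf.map_neg, ← hf.toIsLogicHom.map_meet, ← hf.toIsLogicHom.map_meet, hf.E_map, hf.E_map,
    hf.E_map]

theorem IsRVIso.modelsARV_iff (hf : IsRVIso f) (hM : ModelsRV M) (hN : ModelsRV N) :
    ModelsARV M ↔ ModelsARV N := by
  refine ⟨fun h => ⟨hN, fun y => ?_⟩, fun h => ⟨hM, fun x => ?_⟩⟩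
  · obtain ⟨x, rfl⟩ := hf.bijective.2 y
    rw [← hf.iInf_arv_eq, h.arv]
  · rw [hf.iInf_arv_eq, h.arv]

end Transfer

/-! ### Atomless measures -/

section Atomless

variable {Ω : Type*} [MeasurableSpace Ω]

/-- In a finite atomless measure every set of positive measure has subsets of arbitrarily small
positive measure. -/
theorem Atomless.exists_subset_lt {ν : Measure Ω} [IsFiniteMeasure ν] (hν : Atomless ν)
    {A : Set Ω} (hA : MeasurableSet A) (hpos : 0 < ν A) {ε : ℝ} (hε : 0 < ε) :
    ∃ B ⊆ A, MeasurableSet B ∧ 0 < ν B ∧ ν.real B < ε := by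
  -- Of a proper piece and its complement in `C`, one has at most half the measure.
  have hhalf : ∀ C : Set Ω, MeasurableSet C → 0 < ν C →
      ∃ B ⊆ C, MeasurableSet B ∧ 0 < ν B ∧ ν.real B ≤ ν.real C / 2 := by
    intro C hC hCpos
    obtain ⟨B, hBC, hB, hB0, hlt⟩ := hν C hC hCpos
    have hsum : ν.real (C \ B) = ν.real C - ν.real B := measureReal_sdiff hBC hB
    have hlt' : ν.real B < ν.real C :=
      (ENNReal.toReal_lt_toReal (measure_ne_top _ _) (measure_ne_top _ _)).2 hlt
    rcases le_total (ν.real B) (ν.real C / 2) with h | h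
    · exact ⟨B, hBC, hB, hB0, h⟩
    · refine ⟨C \ B, Set.sdiff_subset, hC.diff hB, ?_, by linarith⟩
      refine pos_iff_ne_zero.2 fun h0 => ?_
      have : ν.real (C \ B) = 0 := by rw [measureReal_def, h0, ENNReal.toReal_zero]
      linarith
  have hpow : ∀ n : ℕ, ∃ B ⊆ A, MeasurableSet B ∧ 0 < ν B ∧ ν.real B ≤ ν.real A * (1 / 2) ^ n := by
    intro n
    induction n with
    | zero => exact ⟨A, subset_rfl, hA, hpos, by simp⟩
    | succ n ih =>
      obtain ⟨B, hBA, hB, hB0, hle⟩ := ih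
      obtain ⟨C, hCB, hC, hC0, hle'⟩ := hhalf B hB hB0
      refine ⟨C, hCB.trans hBA, hC, hC0, ?_⟩
      rw [pow_succ]
      linarith
  have hA' : 0 < ν.real A := ENNReal.toReal_pos hpos.ne' (measure_ne_top _ _)
  obtain ⟨n, hn⟩ := exists_pow_lt_of_lt_one (div_pos hε hA') (by norm_num : (1 / 2 : ℝ) < 1)
  obtain ⟨B, hBA, hB, hB0, hle⟩ := hpow n
  refine ⟨B, hBA, hB, hB0, hle.trans_lt ?_⟩
  rwa [lt_div_iff₀ hA', mul_comm] at hn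

/-- **Sierpiński's theorem**: a finite atomless measure takes all intermediate values. -/
theorem Atomless.exists_measureReal_eq {ν : Measure Ω} [IsFiniteMeasure ν] (hν : Atomless ν)
    {s : ℝ} (hs0 : 0 ≤ s) (hs : s ≤ ν.real Set.univ) :
    ∃ B, MeasurableSet B ∧ ν.real B = s := by
  let P : Type _ := {B : Set Ω // MeasurableSet B ∧ ν.real B ≤ s}
  -- The measures of sets that can still be added to `B` without exceeding `s`. The greedy step
  -- gains at least half of their supremum.
  let V : P → Set ℝ := fun B => {r | ∃ C, MeasurableSet C ∧ Disjoint B.1 C ∧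
    ν.real C ≤ s - ν.real B.1 ∧ r = ν.real C}
  have hbdd : ∀ B : P, BddAbove (V B) := fun B => ⟨s - ν.real B.1, by
    rintro _ ⟨C, _, _, h, rfl⟩
    exact h⟩
  have hstep : ∀ B : P, ∃ B' : P, B.1 ⊆ B'.1 ∧
      sSup (V B) / 2 ≤ ν.real B'.1 - ν.real B.1 := by
    intro B
    have hne : (0 : ℝ) ∈ V B := ⟨∅, MeasurableSet.empty, Set.disjoint_empty _, by
      simpa using B.2.2, by simp⟩
    have hsup : 0 ≤ sSup (V B) := le_csSup (hbdd B) hne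
    rcases hsup.eq_or_lt with h0 | h0
    · exact ⟨B, subset_rfl, by rw [← h0]; simp⟩
    · obtain ⟨_, ⟨C, hC, hd, hle, rfl⟩, hlt⟩ := exists_lt_of_lt_csSup ⟨0, hne⟩ (half_lt_self h0)
      have hU : ν.real (B.1 ∪ C) = ν.real B.1 + ν.real C := measureReal_union hd hC
      refine ⟨⟨B.1 ∪ C, B.2.1.union hC, by linarith⟩, Set.subset_union_left, ?_⟩
      change _ ≤ ν.real (B.1 ∪ C) - _
      linarith
  choose next hsub hgain using hstep
  let B : ℕ → P := fun n => next^[n] ⟨∅, MeasurableSet.empty, by simpa using hs0⟩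
  have hBsucc : ∀ n, B (n + 1) = next (B n) := fun n => Function.iterate_succ_apply' next n _
  have hmono : Monotone fun n => (B n).1 := monotone_nat_of_le_succ fun n => by
    change (B n).1 ⊆ (B (n + 1)).1
    rw [hBsucc]
    exact hsub _
  have hmeas : MeasurableSet (⋃ n, (B n).1) := MeasurableSet.iUnion fun n => (B n).2.1
  have htend : Filter.Tendsto (fun n => ν.real (B n).1) Filter.atTop
      (nhds (ν.real (⋃ n, (B n).1))) :=
    (ENNReal.tendsto_toReal (measure_ne_top _ _)).comp (tendsto_measure_iUnion_atTop hmono)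
  have hle : ν.real (⋃ n, (B n).1) ≤ s := le_of_tendsto' htend fun n => (B n).2.2
  refine ⟨_, hmeas, hle.antisymm (not_lt.1 fun hlt => ?_)⟩
  have hcompl : 0 < ν (⋃ n, (B n).1)ᶜ := by
    refine pos_iff_ne_zero.2 fun h0 => ?_
    have h1 : ν.real (⋃ n, (B n).1)ᶜ = 0 := by rw [measureReal_def, h0, ENNReal.toReal_zero]
    rw [measureReal_compl hmeas] at h1
    linarith
  obtain ⟨C, hCsub, hC, hC0, hClt⟩ := hν.exists_subset_lt hmeas.compl hcompl (sub_pos.2 hlt)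
  have hC0' : 0 < ν.real C := ENNReal.toReal_pos hC0.ne' (measure_ne_top _ _)
  -- If the union fell short of `s`, this small `C` in its complement would be admissible at every
  -- stage, so the gains could not tend to `0`.
  have hgap : ∀ n, ν.real C / 2 ≤ ν.real (B (n + 1)).1 - ν.real (B n).1 := by
    intro n
    rw [hBsucc]
    refine le_trans ?_ (hgain (B n))
    have : ν.real C ≤ sSup (V (B n)) := le_csSup (hbdd _) ⟨C, hC,
      (disjoint_compl_right.mono_right hCsub).mono_left (Set.subset_iUnion (fun n => (B n).1) n),
      by linarith [measureReal_mono (μ := ν) (Set.subset_iUnion (fun n => (B n).1) n)], rfl⟩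
    linarith
  have hzero : Filter.Tendsto (fun n => ν.real (B (n + 1)).1 - ν.real (B n).1) Filter.atTop
      (nhds 0) := by
    simpa using (htend.comp (Filter.tendsto_add_atTop_nat 1)).sub htend
  linarith [ge_of_tendsto' hzero hgap]

/-- A set is null for the new measure exactly when its part where `g ≠ 0` is `μ`-null; so splitting
that part of `A` for `μ` splits `A` for the new measure. -/
theorem Atomless.withDensity {μ : Measure Ω} [IsFiniteMeasure μ] (hμ : Atomless μ)
    {g : Ω → ENNReal} (hg : Measurable g) [IsFiniteMeasure (μ.withDensity g)] :
    Atomless (μ.withDensity g) := by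
  intro A hA hpos
  have hsupp : MeasurableSet {ω | g ω ≠ 0} := hg (measurableSet_singleton 0).compl
  have hzero : ∀ B, MeasurableSet B → (μ.withDensity g B = 0 ↔ μ ({ω | g ω ≠ 0} ∩ B) = 0) :=
    fun B hB => withDensity_apply_eq_zero hg
  have hpos' : 0 < μ ({ω | g ω ≠ 0} ∩ A) := pos_iff_ne_zero.2 fun h =>
    hpos.ne' ((hzero A hA).2 h)
  obtain ⟨B, hBsub, hB, hB0, hlt⟩ := hμ _ (hsupp.inter hA) hpos'
  have hBA : B ⊆ A := hBsub.trans Set.inter_subset_right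
  have hBs : {ω | g ω ≠ 0} ∩ B = B :=
    Set.inter_eq_right.2 (hBsub.trans Set.inter_subset_left)
  refine ⟨B, hBA, hB, pos_iff_ne_zero.2 fun h => hB0.ne' ?_, ?_⟩
  · rwa [hzero B hB, hBs] at h
  · refine (measure_mono hBA).lt_of_ne fun heq => ?_
    have h1 : μ.withDensity g (A \ B) = 0 := by
      rw [measure_sdiff hBA hB.nullMeasurableSet (measure_ne_top _ _), heq, tsub_self]
    rw [hzero _ (hA.diff hB), ← Set.inter_sdiff_assoc,
      measure_sdiff hBsub hB.nullMeasurableSet (measure_ne_top _ _), tsub_eq_zero_iff_le] at h1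
    exact hlt.not_ge h1

end Atomless

/-! ### Atomlessness of spaces of random variables -/

section ARV

variable {Ω : Type*} [MeasurableSpace Ω] (μ : Measure Ω) [IsProbabilityMeasure μ]

/-- The class of the indicator function of a measurable set. -/
noncomputable def L1I.indicator {B : Set Ω} (hB : MeasurableSet B) : L1I μ :=
  ⟨indicatorConstLp 1 hB (measure_ne_top μ B) (1 : ℝ), by
    filter_upwards [indicatorConstLp_coeFn (p := 1) (hs := hB) (hμs := measure_ne_top μ B)
      (c := (1 : ℝ))] with ω h
    rw [h]
    by_cases hω : ω ∈ B <;> simp [hω]⟩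

theorem L1I.coeFn_indicator {B : Set Ω} (hB : MeasurableSet B) :
    (L1I.indicator μ hB).1 =ᵐ[μ] B.indicator fun _ => (1 : ℝ) :=
  indicatorConstLp_coeFn (hs := hB) (hμs := measure_ne_top μ B)

theorem L1I.coeFn_meet_neg (f : L1I μ) :
    (meet f (neg f)).1 =ᵐ[μ] fun ω => min (1 - f.1 ω) (f.1 ω) := by
  filter_upwards [L1I.coeFn_meet f (neg f), L1I.coeFn_neg f] with ω h1 h2
  rw [h1, h2]

theorem L1I.coeFn_meet_indicator (f : L1I μ) {B : Set Ω} (hB : MeasurableSet B) :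
    (meet f (L1I.indicator μ hB)).1 =ᵐ[μ] B.indicator f.1 := by
  filter_upwards [L1I.coeFn_meet f (L1I.indicator μ hB), L1I.coeFn_indicator μ hB, f.2]
    with ω h1 h2 hf
  rw [h1, h2]
  by_cases hω : ω ∈ B
  · simpa [hω] using hf.2
  · simpa [hω] using hf.1

variable {μ}

theorem Atomless.modelsARV (hμ : Atomless μ) : ModelsARV (L1I μ) where
  toModelsRV := L1I.modelsRV μ
  arv f := by
    have hM := L1I.modelsRV μ
    have hbdd : BddBelow (Set.range fun y : L1I μ =>
        max (E (meet y (neg y))) |E (meet y f) - E f / 2|) := ⟨0, by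
      rintro _ ⟨y, rfl⟩
      exact le_max_of_le_right (abs_nonneg _)⟩
    have : Nonempty (L1I μ) := ⟨f⟩
    refine le_antisymm ?_ (le_ciInf fun y => le_max_of_le_right (abs_nonneg _))
    let g : Ω → ENNReal := fun ω => ENNReal.ofReal (f.1 ω)
    have hg : Measurable g := (Lp.stronglyMeasurable f.1).measurable.ennreal_ofReal
    have hfin : IsFiniteMeasure (μ.withDensity g) :=
      isFiniteMeasure_withDensity_ofReal (L1I.integrable f).2
    have hreal : ∀ B, MeasurableSet B → (μ.withDensity g).real B = ∫ ω in B, f.1 ω ∂μ := by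
      intro B hB
      rw [measureReal_def, withDensity_apply _ hB, integral_eq_lintegral_of_nonneg_ae]
      · filter_upwards [ae_restrict_of_ae f.2] with ω h using h.1
      · exact (L1I.integrable f).1.restrict
    have hE : (μ.withDensity g).real Set.univ = E f := by
      rw [hreal _ MeasurableSet.univ, setIntegral_univ, L1I.E_eq]
    -- Sierpiński for the measure `f dμ`: `B` carries half of `E f`, and its indicator annihilates
    -- both terms of the maximum.
    obtain ⟨B, hB, hBs⟩ := (hμ.withDensity hg).exists_measureReal_eq (s := E f / 2)
      (by linarith [E_nonneg f]) (by linarith [E_nonneg f])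
    refine (ciInf_le hbdd (L1I.indicator μ hB)).trans ?_
    rw [hM.meet_comm _ f, L1I.E_eq_of_ae (L1I.coeFn_meet_indicator μ f hB),
      integral_indicator hB, ← hreal B hB, hBs, sub_self, abs_zero]
    refine max_le (le_of_eq ?_) le_rfl
    have h0 : (meet (L1I.indicator μ hB) (neg (L1I.indicator μ hB))).1 =ᵐ[μ] fun _ => (0 : ℝ) := by
      filter_upwards [L1I.coeFn_meet_neg μ (L1I.indicator μ hB), L1I.coeFn_indicator μ hB]
        with ω h1 h2
      rw [h1, h2]
      by_cases hω : ω ∈ B <;> simp [hω]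
    rw [L1I.E_eq_of_ae h0, integral_zero]

theorem ModelsARV.atomless (h : ModelsARV (L1I μ)) : Atomless μ := by
  intro A hA hpos
  by_contra! hatom
  have hA0 : 0 < μ.real A := ENNReal.toReal_pos hpos.ne' (measure_ne_top _ _)
  have hdich : ∀ B ⊆ A, MeasurableSet B → μ B = 0 ∨ μ (A \ B) = 0 := by
    intro B hBA hB
    rcases eq_or_ne (μ B) 0 with h0 | h0
    · exact Or.inl h0
    · right
      rw [measure_sdiff hBA hB.nullMeasurableSet (measure_ne_top _ _),
        (hatom B hBA hB (pos_iff_ne_zero.2 h0)).antisymm (measure_mono hBA), tsub_self]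
  have hM := L1I.modelsRV μ
  have : Nonempty (L1I μ) := ⟨RVOps.zero⟩
  have hinf := h.arv (L1I.indicator μ hA)
  -- With tolerance `μ(A)/4`, the integral of `y` over `A` lies strictly between `μ(A)/4` and
  -- `3μ(A)/4`.
  obtain ⟨y, hy⟩ := exists_lt_of_ciInf_lt (hinf.trans_lt (by linarith : 0 < μ.real A / 4))
  rw [max_lt_iff, abs_lt] at hy
  have hEA : E (L1I.indicator μ hA) = μ.real A := by
    rw [L1I.E_eq_of_ae (L1I.coeFn_indicator μ hA), integral_indicator_const _ hA]
    simp
  have hEy : E (meet y (L1I.indicator μ hA)) = ∫ ω in A, y.1 ω ∂μ := by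
    rw [L1I.E_eq_of_ae (L1I.coeFn_meet_indicator μ y hA), integral_indicator hA]
  have hmin : ∫ ω in A, min (1 - y.1 ω) (y.1 ω) ∂μ ≤ E (meet y (neg y)) := by
    rw [L1I.E_eq_of_ae (L1I.coeFn_meet_neg μ y)]
    refine setIntegral_le_integral ((L1I.integrable _).congr (L1I.coeFn_meet_neg μ y)) ?_
    filter_upwards [y.2] with ω hω
    exact le_min (by simpa using hω.2) hω.1
  rw [hEA, hEy] at hy
  obtain ⟨hy1, hy2, hy3⟩ := hy
  have hyA : IntegrableOn y.1 A μ := (L1I.integrable y).integrableOn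
  -- On the atom, `y` is almost everywhere at most `1/2` or almost everywhere above it. So `min (1 -
  -- y) y` is `y` or `1 - y` there, with integral above `μ(A)/4` either way.
  let B : Set Ω := A ∩ {ω | 1 / 2 < y.1 ω}
  have hB : MeasurableSet B :=
    hA.inter (measurableSet_lt measurable_const (Lp.stronglyMeasurable y.1).measurable)
  rcases hdich B Set.inter_subset_left hB with h0 | h0
  · have : ∫ ω in A, min (1 - y.1 ω) (y.1 ω) ∂μ = ∫ ω in A, y.1 ω ∂μ := by
      refine setIntegral_congr_ae hA ?_
      filter_upwards [measure_eq_zero_iff_ae_notMem.1 h0] with ω hω hωA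
      have : ¬ (1 / 2 < y.1 ω) := fun hlt => hω ⟨hωA, hlt⟩
      exact min_eq_right (by linarith)
    linarith
  · have : ∫ ω in A, min (1 - y.1 ω) (y.1 ω) ∂μ = ∫ ω in A, (1 - y.1 ω) ∂μ := by
      refine setIntegral_congr_ae hA ?_
      filter_upwards [measure_eq_zero_iff_ae_notMem.1 h0] with ω hω hωA
      have : 1 / 2 < y.1 ω := by
        by_contra hlt
        exact hω ⟨hωA, fun hωB => hlt hωB.2⟩
      exact min_eq_left (by linarith)
    rw [integral_sub (integrable_const _) hyA] at this
    simp only [integral_const, MeasurableSet.univ, measureReal_restrict_apply, Set.univ_inter,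
      smul_eq_mul, mul_one] at this
    linarith

theorem modelsARV_L1I_iff : ModelsARV (L1I μ) ↔ Atomless μ :=
  ⟨ModelsARV.atomless, Atomless.modelsARV⟩

end ARV

end RandomVar

theorem mainTheorem6 :
    -- every model of `RV` is based on its Stone space with a unique measure, and the properties
    -- of this representation characterise it up to a unique measure preserving homeomorphism
    (∀ (M : Type u) [MetricSpace M] [RVStructure M], ModelsRV M →
      CompactSpace (StoneSpace M) ∧ T2Space (StoneSpace M) ∧
      Function.Bijective (stoneMap M) ∧ IsLogicHom (stoneMap M) ∧
      ∃ (μ : Measure (StoneSpace M)) (_ : IsProbabilityMeasure μ),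
        IsBasedOn M (StoneSpace M) μ (stoneMap M) ∧
        (∀ (ν : Measure (StoneSpace M)) [IsProbabilityMeasure ν],
          ν.Regular → IsRVIso (rho ν ∘ stoneMap M) → ν = μ) ∧
        ∀ (X : Type v) [TopologicalSpace X] [MeasurableSpace X] [BorelSpace X]
          (ν : Measure X) [IsProbabilityMeasure ν] (θ : M → C(X, unitInterval)),
          IsBasedOn M X ν θ →
          ∃! h : X ≃ₜ StoneSpace M,
            MeasurePreserving h ν μ ∧ ∀ (a : M) (x : X), stoneMap M a (h x) = θ a x) ∧
    -- the models of `RV` are, up to isomorphism, exactly the spaces `L¹(μ,[0,1])`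
    (∀ (M : Type u) [MetricSpace M] [RVStructure M], ModelsRV M ↔
      ∃ (Ω : Type u) (_ : MeasurableSpace Ω) (μ : Measure Ω) (_ : IsProbabilityMeasure μ)
        (f : M → L1I μ), IsRVIso f) ∧
    (∀ (Ω : Type w) [MeasurableSpace Ω] (μ : Measure Ω) [IsProbabilityMeasure μ],
      ModelsRV (L1I μ)) ∧
    -- the models of `ARV` are exactly those coming from atomless probability spaces
    (∀ (M : Type u) [MetricSpace M] [RVStructure M], ModelsARV M ↔
      ∃ (Ω : Type u) (_ : MeasurableSpace Ω) (μ : Measure Ω) (_ : IsProbabilityMeasure μ)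
        (f : M → L1I μ), Atomless μ ∧ IsRVIso f) ∧
    (∀ (Ω : Type w) [MeasurableSpace Ω] (μ : Measure Ω) [IsProbabilityMeasure μ],
      ModelsARV (L1I μ) ↔ Atomless μ) := by
  refine ⟨fun M _ _ hM => ?_, fun M _ _ => ⟨fun hM => ?_, ?_⟩, fun Ω _ μ _ => L1I.modelsRV μ,
    fun M _ _ => ⟨fun hM => ?_, ?_⟩, fun Ω _ μ _ => modelsARV_L1I_iff⟩
  · obtain ⟨μ, hprob, hμ⟩ := hM.exists_isBasedOn
    refine ⟨inferInstance, inferInstance, hM.stoneMap_bijective, isLogicHom_stoneMap M, μ, hprob,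
      hμ, fun ν _ hreg hiso => ?_, fun X _ _ _ ν _ θ hν => hM.existsUnique_homeomorph hμ hν⟩
    exact hM.measure_unique hμ.regular hreg (integral_eq_E_of_isRVIso hμ.isRVIso)
      (integral_eq_E_of_isRVIso hiso)
  · obtain ⟨μ, hprob, hμ⟩ := hM.exists_isBasedOn
    exact ⟨StoneSpace M, inferInstance, μ, hprob, _, hμ.isRVIso⟩
  · rintro ⟨Ω, _, μ, _, f, hf⟩
    exact hf.modelsRV (L1I.modelsRV μ)
  · obtain ⟨μ, hprob, hμ⟩ := hM.toModelsRV.exists_isBasedOn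
    refine ⟨StoneSpace M, inferInstance, μ, hprob, _, ?_, hμ.isRVIso⟩
    exact modelsARV_L1I_iff.1
      ((hμ.isRVIso.modelsARV_iff hM.toModelsRV (L1I.modelsRV μ)).1 hM)
  · rintro ⟨Ω, _, μ, _, f, hμ, hf⟩
    exact (hf.modelsARV_iff (hf.modelsRV (L1I.modelsRV μ)) (L1I.modelsRV μ)).2 hμ.modelsARV
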